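/- Let $K$ be a field, let $q,Q\in K^\times$, and let $n,d\ge 0$ be integers. Put $r=\lfloor n/2\rfloor$ and let $I(n)=[-r,r]\cap\mathbb Z$ if $n$ is odd and $I(n)=([-r,r]\cap\mathbb Z)\setminus\{0\}$ if $n$ is even. Let $\mathcal H=\mathcal H^{\mathrm B}_{Q,q}(d)$ be the $K$-algebra generated by $T_0,\dots,T_{d-1}$ with relations $T_iT_{i+1}T_i=T_{i+1}T_iT_{i+1}$ ($1\le i\le d-2$), $(T_0T_1)^2=(T_1T_0)^2$, $T_iT_j=T_jT_i$ ($|i-j|>1$), $T_0^2=(Q^{-1}-Q)T_0+1$ and $T_i^2=(q^{-1}-q)T_i+1$ ($1\le i\le d-1$). Let $V$ be the $K$-space with basis $\{v_i\}_{i\in I(n)}$ and write $v_\mu=v_{\mu_1}\otimes\cdots\otimes v_{\mu_d}$ for $\mu\in I(n)^d$. The algebra $\mathcal H$ acts on $V^{\otimes d}$ from the right as follows. For $1\le t\le d-1$, let $\mu\cdot s_t$ be $\mu$ with the entries $\mu_t,\mu_{t+1}$ interchanged; then $v_\mu T_t$ is $v_{\mu\cdot s_t}$ if $\mu_t<\mu_{t+1}$,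 is $q^{-1}v_{\mu\cdot s_t}$ if $\mu_t=\mu_{t+1}$, and is $v_{\mu\cdot s_t}+(q^{-1}-q)v_\mu$ if $\mu_t>\mu_{t+1}$. Let $\mu\cdot s_0=(-\mu_1,\mu_2,\dots,\mu_d)$; then $v_\mu T_0$ is $v_{\mu\cdot s_0}$ if $\mu_1>0$, is $Q^{-1}v_{\mu\cdot s_0}$ if $\mu_1=0$, and is $v_{\mu\cdot s_0}+(Q^{-1}-Q)v_\mu$ if $\mu_1<0$. Let $S=S^{\mathrm B}_{Q,q}(n,d)=\mathrm{End}_{\mathcal H}(V^{\otimes d})$, acting on $V^{\otimes d}$ from the left. If $\lfloor n/2\rfloor\ge d$, then there are an idempotent $e\in S$ and an isomorphism of $K$-algebras $\psi:eSe\to\mathcal H$ such that the following hold. (a) $Se\cong V^{\otimes d}$ as $(S,\mathcal H)$-bimodules, where $S$ acts on $Se$ by left multiplication and $h\in\mathcal H$ acts by right multiplication with $\psi^{-1}(h)$. (b) Transposition of matrices with respect to the basis $\{v_\mu\}$ restricts to an anti-automorphism $\tau$ of the $K$-algebra $S$; there is an anti-automorphism $\sigma$ of the $K$-algebra $\mathcal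 H$ with $\sigma(T_t)=T_t$ for all $t$; and $eS\cong V^{\otimes d}$ as $(S,\mathcal H)$-bimodules, where $s\in S$ and $h\in\mathcal H$ act on $x\in eS$ by $s\cdot x=x\,\tau(s)$ and $x\cdot h=\psi^{-1}(\sigma(h))\,x$. (c) There is a functor from left $S$-modules to left $\mathcal H$-modules (the Schur functor of type B) that sends $M$ to $eM$, on which $h\in\mathcal H$ acts as $\psi^{-1}(h)\in eSe$, and that sends an $S$-linear map to its restriction. -/

import Mathlib

open MulOpposite

universe u w

namespace TypeB

/-- The index set `I(n)`: with `r = ⌊n/2⌋` it consists of the integers in `[-r, r]`,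
where `0` is left out if `n` is even. -/
abbrev Idx (n : ℕ) : Type :=
  {i : ℤ // i ∈ (Finset.Icc (-((n / 2 : ℕ) : ℤ)) ((n / 2 : ℕ) : ℤ)).filter
    (fun i => Odd n ∨ i ≠ 0)}

/-- The involution `i ↦ -i` of `I(n)`. -/
def Idx.neg {n : ℕ} (i : Idx n) : Idx n :=
  ⟨-i.1, by
    have h := i.2
    simp only [Finset.mem_filter, Finset.mem_Icc] at h ⊢
    refine ⟨⟨by linarith [h.1.2], by linarith [h.1.1]⟩, ?_⟩
    simpa using h.2⟩

section Hecke

variable {K : Type u} [Field K]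

/-- The defining relations of the two-parameter Hecke algebra of type B on the generators
`T_0, …, T_{d-1}`. -/
inductive HeckeRel (Q q : Kˣ) (d : ℕ) : FreeAlgebra K (Fin d) → FreeAlgebra K (Fin d) → Prop
  | braid (i j : Fin d) (hi : 1 ≤ i.val) (hj : j.val = i.val + 1) :
      HeckeRel Q q d
        (FreeAlgebra.ι K i * FreeAlgebra.ι K j * FreeAlgebra.ι K i)
        (FreeAlgebra.ι K j * FreeAlgebra.ι K i * FreeAlgebra.ι K j)
  | braid_zero (i j : Fin d) (hi : i.val = 0) (hj : j.val = 1) :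
      HeckeRel Q q d
        ((FreeAlgebra.ι K i * FreeAlgebra.ι K j) ^ 2)
        ((FreeAlgebra.ι K j * FreeAlgebra.ι K i) ^ 2)
  | comm (i j : Fin d) (hij : i.val + 1 < j.val) :
      HeckeRel Q q d
        (FreeAlgebra.ι K i * FreeAlgebra.ι K j)
        (FreeAlgebra.ι K j * FreeAlgebra.ι K i)
  | quad_zero (i : Fin d) (hi : i.val = 0) :
      HeckeRel Q q d
        (FreeAlgebra.ι K i ^ 2)
        (((↑Q⁻¹ : K) - (Q : K)) • FreeAlgebra.ι K i + 1)
  | quad (i : Fin d) (hi : 1 ≤ i.val) :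
      HeckeRel Q q d
        (FreeAlgebra.ι K i ^ 2)
        (((↑q⁻¹ : K) - (q : K)) • FreeAlgebra.ι K i + 1)

/-- The two-parameter Hecke algebra of type B. -/
def HeckeB (Q q : Kˣ) (d : ℕ) : Type u := RingQuot (HeckeRel Q q d)

noncomputable instance (Q q : Kˣ) (d : ℕ) : Ring (HeckeB Q q d) :=
  inferInstanceAs (Ring (RingQuot (HeckeRel Q q d)))

noncomputable instance (Q q : Kˣ) (d : ℕ) : Algebra K (HeckeB Q q d) :=
  inferInstanceAs (Algebra K (RingQuot (HeckeRel Q q d)))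

/-- The generator `T_t` of the Hecke algebra. -/
noncomputable def HeckeB.T (Q q : Kˣ) {d : ℕ} (t : Fin d) : HeckeB Q q d :=
  RingQuot.mkAlgHom K (HeckeRel Q q d) (FreeAlgebra.ι K t)

end Hecke

/-- The tensor space `V^{⊗d}`, where `V` is the `K`-space with basis indexed by `I(n)`. -/
def TensorSpace (K : Type u) [Field K] (n d : ℕ) : Type u :=
  PiTensorProduct K (fun _ : Fin d => (Idx n → K))

noncomputable instance (K : Type u) [Field K] (n d : ℕ) : AddCommGroup (TensorSpace K n d) :=
  inferInstanceAs (AddCommGroup (PiTensorProduct K (fun _ : Fin d => (Idx n → K))))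

noncomputable instance (K : Type u) [Field K] (n d : ℕ) : Module K (TensorSpace K n d) :=
  inferInstanceAs (Module K (PiTensorProduct K (fun _ : Fin d => (Idx n → K))))

/-- The basis `v_μ = v_{μ_1} ⊗ … ⊗ v_{μ_d}`, `μ ∈ I(n)^d`, of the tensor space. -/
noncomputable def tensorBasis (K : Type u) [Field K] (n d : ℕ) :
    Module.Basis (Fin d → Idx n) K (TensorSpace K n d) :=
  Basis.piTensorProduct (fun _ : Fin d => Pi.basisFun K (Idx n))

/-- The position before `t`. For `t ≠ 0` the generator `T_t` acts in the positions `t - 1` and `t`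
(the positions being counted from `0`). -/
def prevPos {d : ℕ} (t : Fin d) : Fin d := ⟨t.val - 1, by omega⟩

/-- The place permutation `μ · s_t`. -/
def placeAct {n d : ℕ} (t : Fin d) (μ : Fin d → Idx n) : Fin d → Idx n :=
  if t.val = 0 then Function.update μ t (μ t).neg
  else μ ∘ Equiv.swap (prevPos t) t

theorem braid_abs {K M α : Type*} [Field K] [AddCommGroup M] [Module K M] [LinearOrder α]
    (r : Kˣ) (G : α → α → α → M) (A B : Module.End K M)
    (hA1 : ∀ a b c, a < b → A (G a b c) = G b a c)
    (hA2 : ∀ a c, A (G a a c) = (↑r⁻¹ : K) • G a a c)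
    (hA3 : ∀ a b c, b < a → A (G a b c) = G b a c + ((↑r⁻¹ : K) - (r : K)) • G a b c)
    (hB1 : ∀ a b c, b < c → B (G a b c) = G a c b)
    (hB2 : ∀ a b, B (G a b b) = (↑r⁻¹ : K) • G a b b)
    (hB3 : ∀ a b c, c < b → B (G a b c) = G a c b + ((↑r⁻¹ : K) - (r : K)) • G a b c)
    (a b c : α) : A (B (A (G a b c))) = B (A (B (G a b c))) := by
  have hr : (↑r⁻¹ : K) * (r : K) = 1 := by simp
  generalize (↑r⁻¹ : K) = x at *
  generalize (r : K) = y at *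
  rcases lt_trichotomy a b with h1 | h1 | h1 <;> rcases lt_trichotomy b c with h2 | h2 | h2 <;>
    rcases lt_trichotomy a c with h3 | h3 | h3 <;> (try subst h1) <;> (try subst h2) <;>
    (try subst h3) <;>
    first
    | (exfalso; order)
    | (simp only [hA1, hA2, hA3, hB1, hB2, hB3, map_add, map_smul, *]; done)
    | (simp only [hA1, hA2, hA3, hB1, hB2, hB3, map_add, map_smul, *]; module)
    | (simp only [hA1, hA2, hA3, hB1, hB2, hB3, map_add, map_smul, *]
       match_scalars <;> grind)

set_option maxHeartbeats 1000000 in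
theorem braid0_abs {K M α : Type*} [Field K] [AddCommGroup M] [Module K M] [LinearOrder α]
    (ng : α → α) (val : α → ℤ) (hv : ∀ a b, a < b ↔ val a < val b)
    (hng : ∀ a, ng (ng a) = a) (hval : ∀ a, val (ng a) = - val a)
    (Q r : Kˣ) (G : α → α → M) (A B : Module.End K M)
    (hA1 : ∀ a b, 0 < val a → A (G a b) = G (ng a) b)
    (hA2 : ∀ a b, 0 = val a → A (G a b) = (↑Q⁻¹ : K) • G a b)
    (hA3 : ∀ a b, val a < 0 → A (G a b) = G (ng a) b + ((↑Q⁻¹ : K) - (Q : K)) • G a b)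
    (hB1 : ∀ b c, b < c → B (G b c) = G c b)
    (hB2 : ∀ b, B (G b b) = (↑r⁻¹ : K) • G b b)
    (hB3 : ∀ b c, c < b → B (G b c) = G c b + ((↑r⁻¹ : K) - (r : K)) • G b c)
    (a b : α) : B (A (B (A (G a b)))) = A (B (A (B (G a b)))) := by
  have hr : (↑r⁻¹ : K) * (r : K) = 1 := by simp
  have hQ : (↑Q⁻¹ : K) * (Q : K) = 1 := by simp
  generalize (↑r⁻¹ : K) = x at *
  generalize (r : K) = y at *
  generalize (↑Q⁻¹ : K) = X at *
  generalize (Q : K) = Y at *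
  have hinj : ∀ a b, val a = val b → a = b := by
    intro a b h
    rcases lt_trichotomy a b with h' | h' | h'
    · rw [hv] at h'; omega
    · exact h'
    · rw [hv] at h'; omega
  have hneg : ∀ a b, val a = - val b → a = ng b := fun a b h => hinj _ _ (by rw [hval, h])
  have hB1' : ∀ b c, val b < val c → B (G b c) = G c b := fun b c h => hB1 b c ((hv _ _).2 h)
  have hB3' : ∀ b c, val c < val b → B (G b c) = G c b + (x - y) • G b c :=
    fun b c h => hB3 b c ((hv _ _).2 h)
  clear hB1 hB3 hv
  rcases lt_trichotomy (val a) (val b) with h1 | h1 | h1 <;>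
    rcases lt_trichotomy (val a) (-val b) with h2 | h2 | h2 <;>
    rcases lt_trichotomy (val a) 0 with h3 | h3 | h3 <;>
    rcases lt_trichotomy (val b) 0 with h4 | h4 | h4 <;>
    first
    | (exfalso; omega)
    | skip
  all_goals try (obtain rfl := hinj _ _ h1)
  all_goals try (obtain rfl := hneg _ _ h2)
  all_goals try rw [hval] at h1
  all_goals try rw [hval] at h2
  all_goals try rw [hval] at h3
  all_goals first
    | (simp (disch := first | assumption | (simp only [hval]; omega) | omega) only
        [hA1, hA2, hA3, hB1', hB2, hB3', hng, map_add, map_smul]; done)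
    | (simp (disch := first | assumption | (simp only [hval]; omega) | omega) only
        [hA1, hA2, hA3, hB1', hB2, hB3', hng, map_add, map_smul]; module)
    | (simp (disch := first | assumption | (simp only [hval]; omega) | omega) only
        [hA1, hA2, hA3, hB1', hB2, hB3', hng, map_add, map_smul]
       match_scalars <;> grind)

section Action

variable {K : Type u} [Field K]

/-- The vector `v_μ T_t`. -/
noncomputable def basisAct (Q q : Kˣ) {n d : ℕ} (t : Fin d) (μ : Fin d → Idx n) :
    TensorSpace K n d :=
  if t.val = 0 then
    if 0 < (μ t).1 then tensorBasis K n d (placeAct t μ)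
    else if 0 = (μ t).1 then (↑Q⁻¹ : K) • tensorBasis K n d (placeAct t μ)
    else tensorBasis K n d (placeAct t μ) + ((↑Q⁻¹ : K) - (Q : K)) • tensorBasis K n d μ
  else
    if μ (prevPos t) < μ t then tensorBasis K n d (placeAct t μ)
    else if μ (prevPos t) = μ t then (↑q⁻¹ : K) • tensorBasis K n d (placeAct t μ)
    else tensorBasis K n d (placeAct t μ) + ((↑q⁻¹ : K) - (q : K)) • tensorBasis K n d μ

/-- The operator `v ↦ v T_t` on the tensor space. -/
noncomputable def genAct (Q q : Kˣ) (n : ℕ) {d : ℕ} (t : Fin d) :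
    Module.End K (TensorSpace K n d) :=
  (tensorBasis K n d).constr K (basisAct Q q t)

theorem genAct_zero (Q q : Kˣ) {n d : ℕ} (t : Fin d) (ht : t.val = 0) (μ : Fin d → Idx n) :
    genAct Q q n t (tensorBasis K n d μ) =
      if 0 < (μ t).1 then tensorBasis K n d (Function.update μ t (μ t).neg)
      else if 0 = (μ t).1 then (↑Q⁻¹ : K) • tensorBasis K n d (Function.update μ t (μ t).neg)
      else tensorBasis K n d (Function.update μ t (μ t).neg)
        + ((↑Q⁻¹ : K) - (Q : K)) • tensorBasis K n d μ := by
  rw [genAct, Module.Basis.constr_basis, basisAct, if_pos ht, placeAct, if_pos ht]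

theorem genAct_pos (Q q : Kˣ) {n d : ℕ} (s t : Fin d) (hst : t.val = s.val + 1)
    (μ : Fin d → Idx n) :
    genAct Q q n t (tensorBasis K n d μ) =
      if μ s < μ t then tensorBasis K n d (μ ∘ Equiv.swap s t)
      else if μ s = μ t then (↑q⁻¹ : K) • tensorBasis K n d (μ ∘ Equiv.swap s t)
      else tensorBasis K n d (μ ∘ Equiv.swap s t)
        + ((↑q⁻¹ : K) - (q : K)) • tensorBasis K n d μ := by
  have hs : prevPos t = s := Fin.ext (by simp [prevPos, hst])
  have ht : t.val ≠ 0 := by omega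
  rw [genAct, Module.Basis.constr_basis, basisAct, if_neg ht, placeAct, if_neg ht, hs]

theorem Idx.neg_neg {n : ℕ} (i : Idx n) : i.neg.neg = i := Subtype.ext (by simp [Idx.neg])

theorem genAct_quad_zero (Q q : Kˣ) {n d : ℕ} (t : Fin d) (ht : t.val = 0) :
    genAct Q q n t ^ 2 = ((↑Q⁻¹ : K) - (Q : K)) • genAct Q q n t + 1 := by
  refine (tensorBasis K n d).ext fun μ => ?_
  have hself : 0 = (μ t).1 → Function.update μ t (μ t).neg = μ := fun h => by
    have : (μ t).neg = μ t := Subtype.ext (by simp [Idx.neg, ← h])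
    rw [this, Function.update_eq_self]
  simp only [pow_two, Module.End.mul_apply, LinearMap.add_apply, LinearMap.smul_apply,
    Module.End.one_apply]
  rcases lt_trichotomy 0 (μ t).1 with h | h | h
  · have h' : ¬ 0 < (μ t).neg.1 := by simp only [Idx.neg]; omega
    have h'' : ¬ 0 = (μ t).neg.1 := by simp only [Idx.neg]; omega
    simp only [genAct_zero Q q t ht, if_pos h, Function.update_self, if_neg h', if_neg h'',
      Idx.neg_neg, Function.update_idem, Function.update_eq_self]
    module
  · have h' : ¬ 0 < (μ t).1 := by omega
    simp only [genAct_zero Q q t ht, if_neg h', if_pos h, map_smul, hself h]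
    match_scalars
    have hQ : (Q : K) ≠ 0 := Q.ne_zero
    field_simp
    ring
  · have h1 : ¬ 0 < (μ t).1 := by omega
    have h2 : ¬ 0 = (μ t).1 := by omega
    have h' : 0 < (μ t).neg.1 := by simp only [Idx.neg]; omega
    simp only [genAct_zero Q q t ht, if_neg h1, if_neg h2, Function.update_self, if_pos h',
      Idx.neg_neg, Function.update_idem, Function.update_eq_self, map_add, map_smul]
    module

theorem comp_swap_swap {ι α : Type*} [DecidableEq ι] (s t : ι) (μ : ι → α) :
    (μ ∘ Equiv.swap s t) ∘ Equiv.swap s t = μ := by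
  funext x; simp

theorem comp_swap_of_eq {ι α : Type*} [DecidableEq ι] (s t : ι) (μ : ι → α) (h : μ s = μ t) :
    μ ∘ Equiv.swap s t = μ := by
  funext x
  by_cases h1 : x = s
  · subst h1; simp [h]
  by_cases h2 : x = t
  · subst h2; simp [h]
  simp [Equiv.swap_apply_of_ne_of_ne h1 h2]

theorem genAct_quad (Q q : Kˣ) {n d : ℕ} (s t : Fin d) (hst : t.val = s.val + 1) :
    genAct Q q n t ^ 2 = ((↑q⁻¹ : K) - (q : K)) • genAct Q q n t + 1 := by
  refine (tensorBasis K n d).ext fun μ => ?_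
  simp only [pow_two, Module.End.mul_apply, LinearMap.add_apply, LinearMap.smul_apply,
    Module.End.one_apply]
  rcases lt_trichotomy (μ s) (μ t) with h | h | h
  · have h1 : ¬ μ t < μ s := h.asymm
    have h2 : ¬ μ t = μ s := h.ne'
    simp only [genAct_pos Q q s t hst, if_pos h, Function.comp_apply, Equiv.swap_apply_left,
      Equiv.swap_apply_right, if_neg h1, if_neg h2, comp_swap_swap]
    module
  · have h' : ¬ μ s < μ t := h.not_lt
    simp only [genAct_pos Q q s t hst, if_neg h', if_pos h, map_smul, comp_swap_of_eq s t μ h]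
    match_scalars
    have hq : (q : K) ≠ 0 := q.ne_zero
    field_simp
    ring
  · have h1 : ¬ μ s < μ t := h.asymm
    have h2 : ¬ μ s = μ t := h.ne'
    simp only [genAct_pos Q q s t hst, if_pos h, Function.comp_apply, Equiv.swap_apply_left,
      Equiv.swap_apply_right, if_neg h1, if_neg h2, comp_swap_swap, map_add, map_smul]
    module

theorem genAct_braid (Q q : Kˣ) {n d : ℕ} (i j : Fin d) (hi : 1 ≤ i.val)
    (hj : j.val = i.val + 1) :
    genAct Q q n i * genAct Q q n j * genAct Q q n i =
      genAct (K := K) Q q n j * genAct Q q n i * genAct Q q n j := by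
  obtain ⟨p, hp⟩ : ∃ p : Fin d, i.val = p.val + 1 := ⟨⟨i.val - 1, by omega⟩, by simp; omega⟩
  have hpi : p ≠ i := fun h => by rw [h] at hp; omega
  have hpj : p ≠ j := fun h => by rw [h] at hp; omega
  have hij : i ≠ j := fun h => by rw [h] at hj; omega
  refine (tensorBasis K n d).ext fun μ => ?_
  let F : Idx n → Idx n → Idx n → (Fin d → Idx n) := fun a b c =>
    Function.update (Function.update (Function.update μ p a) i b) j c
  have Fp : ∀ a b c, F a b c p = a := fun a b c => by simp [F, hpi, hpj]
  have Fi : ∀ a b c, F a b c i = b := fun a b c => by simp [F, hij]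
  have Fj : ∀ a b c, F a b c j = c := fun a b c => by simp [F]
  have Fo : ∀ a b c x, x ≠ p → x ≠ i → x ≠ j → F a b c x = μ x := fun a b c x h1 h2 h3 => by
    simp [F, h1, h2, h3]
  have S1 : ∀ a b c, F a b c ∘ Equiv.swap p i = F b a c := fun a b c => by
    funext x
    by_cases h1 : x = p
    · subst h1; simp [Fp, Fi]
    by_cases h2 : x = i
    · subst h2; simp [Fp, Fi]
    by_cases h3 : x = j
    · subst h3; simp [Equiv.swap_apply_of_ne_of_ne h1 h2, Fj]
    simp [Equiv.swap_apply_of_ne_of_ne h1 h2, Fo _ _ _ x h1 h2 h3]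
  have S2 : ∀ a b c, F a b c ∘ Equiv.swap i j = F a c b := fun a b c => by
    funext x
    by_cases h2 : x = i
    · subst h2; simp [Fj, Fi]
    by_cases h3 : x = j
    · subst h3; simp [Fj, Fi]
    by_cases h1 : x = p
    · subst h1; simp [Equiv.swap_apply_of_ne_of_ne h2 h3, Fp]
    simp [Equiv.swap_apply_of_ne_of_ne h2 h3, Fo _ _ _ x h1 h2 h3]
  have hμ : F (μ p) (μ i) (μ j) = μ := by simp [F]
  have key := braid_abs q (fun a b c => tensorBasis K n d (F a b c))
    (genAct Q q n i) (genAct Q q n j)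
    (fun a b c h => by simp only [genAct_pos Q q p i hp, Fp, Fi, S1, if_pos h])
    (fun a c => by simp only [genAct_pos Q q p i hp, Fp, Fi, S1, lt_irrefl, if_false, if_true])
    (fun a b c h => by simp only [genAct_pos Q q p i hp, Fp, Fi, S1, if_neg h.asymm, if_neg h.ne'])
    (fun a b c h => by simp only [genAct_pos Q q i j hj, Fj, Fi, S2, if_pos h])
    (fun a b => by simp only [genAct_pos Q q i j hj, Fj, Fi, S2, lt_irrefl, if_false, if_true])
    (fun a b c h => by simp only [genAct_pos Q q i j hj, Fj, Fi, S2, if_neg h.asymm, if_neg h.ne'])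
    (μ p) (μ i) (μ j)
  simp only [hμ] at key
  simpa only [Module.End.mul_apply] using key

theorem genAct_braid_zero (Q q : Kˣ) {n d : ℕ} (i j : Fin d) (hi : i.val = 0)
    (hj : j.val = 1) :
    (genAct Q q n i * genAct Q q n j) ^ 2 =
      (genAct (K := K) Q q n j * genAct Q q n i) ^ 2 := by
  have hij : i ≠ j := fun h => by rw [h] at hi; omega
  have hji : j.val = i.val + 1 := by omega
  refine (tensorBasis K n d).ext fun μ => ?_
  let F : Idx n → Idx n → (Fin d → Idx n) := fun a b =>
    Function.update (Function.update μ i a) j b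
  have Fi : ∀ a b, F a b i = a := fun a b => by simp [F, hij]
  have Fj : ∀ a b, F a b j = b := fun a b => by simp [F]
  have S1 : ∀ a b c, Function.update (F a b) i c = F c b := fun a b c => by
    simp only [F]
    rw [Function.update_comm hij.symm, Function.update_idem, Function.update_comm hij]
  have S2 : ∀ a b, F a b ∘ Equiv.swap i j = F b a := fun a b => by
    funext x
    by_cases h2 : x = i
    · subst h2; simp [Fj, Fi]
    by_cases h3 : x = j
    · subst h3; simp [Fj, Fi]
    simp [Equiv.swap_apply_of_ne_of_ne h2 h3, F, h2, h3]
  have hμ : F (μ i) (μ j) = μ := by simp [F]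
  have key := braid0_abs (Idx.neg (n := n)) (fun a => a.1) (fun a b => Iff.rfl)
    Idx.neg_neg (fun a => rfl) Q q (fun a b => tensorBasis K n d (F a b))
    (genAct Q q n i) (genAct Q q n j)
    (fun a b h => by simp only [genAct_zero Q q i hi, Fi, S1, if_pos h])
    (fun a b h => by
      have h' : ¬ 0 < a.1 := by omega
      have h'' : a.neg = a := Subtype.ext (by simp [Idx.neg, ← h])
      simp only [genAct_zero Q q i hi, Fi, S1, if_neg h', if_pos h, h''])
    (fun a b h => by
      have h' : ¬ 0 < a.1 := by omega
      have h'' : ¬ 0 = a.1 := by omega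
      simp only [genAct_zero Q q i hi, Fi, S1, if_neg h', if_neg h''])
    (fun b c h => by simp only [genAct_pos Q q i j hji, Fj, Fi, S2, if_pos h])
    (fun b => by simp only [genAct_pos Q q i j hji, Fj, Fi, S2, lt_irrefl, if_false, if_true])
    (fun b c h => by simp only [genAct_pos Q q i j hji, Fj, Fi, S2, if_neg h.asymm, if_neg h.ne'])
    (μ i) (μ j)
  simp only [hμ] at key
  simpa only [pow_two, Module.End.mul_apply] using key.symm

/-- Operators of the form `b μ ↦ x μ • b (f μ) + y μ • b μ` that do not interact commute. -/
theorem comm_abs {ι M : Type*} [AddCommGroup M] [Module K M] (b : ι → M) (A B : Module.End K M)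
    (f g : ι → ι) (x y x' y' : ι → K)
    (hA : ∀ μ, A (b μ) = x μ • b (f μ) + y μ • b μ)
    (hB : ∀ μ, B (b μ) = x' μ • b (g μ) + y' μ • b μ)
    (hfg : ∀ μ, f (g μ) = g (f μ)) (hx : ∀ μ, x (g μ) = x μ) (hy : ∀ μ, y (g μ) = y μ)
    (hx' : ∀ μ, x' (f μ) = x' μ) (hy' : ∀ μ, y' (f μ) = y' μ) (μ : ι) :
    A (B (b μ)) = B (A (b μ)) := by
  simp only [hA, hB, map_add, map_smul, hfg, hx, hy, hx', hy']
  module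

theorem genAct_comm (Q q : Kˣ) {n d : ℕ} (i j : Fin d) (hij : i.val + 1 < j.val) :
    genAct Q q n i * genAct Q q n j = genAct (K := K) Q q n j * genAct Q q n i := by
  obtain ⟨p, hp⟩ : ∃ p : Fin d, j.val = p.val + 1 := ⟨⟨j.val - 1, by omega⟩, by simp; omega⟩
  have hip : i ≠ p := fun h => by rw [h] at hij; omega
  have hij' : i ≠ j := fun h => by rw [h] at hij; omega
  refine (tensorBasis K n d).ext fun μ => ?_
  have hB : ∀ μ, genAct Q q n j (tensorBasis K n d μ) =
      (if μ p = μ j then (↑q⁻¹ : K) else 1) • tensorBasis K n d (μ ∘ Equiv.swap p j) +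
      (if μ p ≤ μ j then 0 else (↑q⁻¹ : K) - (q : K)) • tensorBasis K n d μ := fun μ => by
    rw [genAct_pos Q q p j hp]
    rcases lt_trichotomy (μ p) (μ j) with h | h | h
    · simp [h, h.le, h.ne]
    · simp [h]
    · simp [h.asymm, h.ne', h.not_ge]
  by_cases hi : i.val = 0
  · have hA : ∀ μ, genAct Q q n i (tensorBasis K n d μ) =
        (if 0 = (μ i).1 then (↑Q⁻¹ : K) else 1) •
          tensorBasis K n d (Function.update μ i (μ i).neg) +
        (if 0 ≤ (μ i).1 then 0 else (↑Q⁻¹ : K) - (Q : K)) • tensorBasis K n d μ := fun μ => by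
      rw [genAct_zero Q q i hi]
      rcases lt_trichotomy 0 (μ i).1 with h | h | h
      · simp [h, h.le, h.ne]
      · simp [← h]
      · simp [h.asymm, h.ne', h.not_ge]
    refine comm_abs (tensorBasis K n d) _ _ _ _ _ _ _ _ hA hB ?_ ?_ ?_ ?_ ?_ μ
    · intro μ
      funext x
      by_cases h1 : x = i
      · subst h1; simp [Equiv.swap_apply_of_ne_of_ne hip hij']
      have h1' : Equiv.swap p j x ≠ i := fun h => h1 (by
        rw [← Equiv.swap_apply_of_ne_of_ne hip hij'] at h
        exact (Equiv.swap p j).injective h)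
      simp [h1, h1']
    all_goals intro μ
    all_goals simp [Equiv.swap_apply_of_ne_of_ne hip hij', hip.symm, hij'.symm]
  · obtain ⟨s, hs⟩ : ∃ s : Fin d, i.val = s.val + 1 := ⟨⟨i.val - 1, by omega⟩, by simp; omega⟩
    have hsp : s ≠ p := fun h => by rw [h] at hs; omega
    have hsj : s ≠ j := fun h => by rw [h] at hs; omega
    have hA : ∀ μ, genAct Q q n i (tensorBasis K n d μ) =
        (if μ s = μ i then (↑q⁻¹ : K) else 1) • tensorBasis K n d (μ ∘ Equiv.swap s i) +
        (if μ s ≤ μ i then 0 else (↑q⁻¹ : K) - (q : K)) • tensorBasis K n d μ := fun μ => by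
      rw [genAct_pos Q q s i hs]
      rcases lt_trichotomy (μ s) (μ i) with h | h | h
      · simp [h, h.le, h.ne]
      · simp [h]
      · simp [h.asymm, h.ne', h.not_ge]
    refine comm_abs (tensorBasis K n d) _ _ _ _ _ _ _ _ hA hB ?_ ?_ ?_ ?_ ?_ μ
    · intro μ
      have hc : Commute (Equiv.swap p j) (Equiv.swap s i) :=
        (Equiv.Perm.disjoint_swap_swap (by simp [*, hsp.symm, hip.symm, hsj.symm, hij'.symm,
          show p ≠ j from fun h => by rw [h] at hp; omega,
          show s ≠ i from fun h => by rw [h] at hs; omega])).commute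
      funext x
      exact congrArg μ (Equiv.Perm.ext_iff.1 hc.eq x)
    all_goals intro μ
    all_goals simp [Equiv.swap_apply_of_ne_of_ne hip hij', Equiv.swap_apply_of_ne_of_ne hsp hsj,
      Equiv.swap_apply_of_ne_of_ne hsp.symm hip.symm,
      Equiv.swap_apply_of_ne_of_ne hsj.symm hij'.symm]

/-- The right action of the Hecke algebra on the tensor space: the generator `T_t` acts by
`v ↦ v T_t`. -/
noncomputable def heckeAct (Q q : Kˣ) (n d : ℕ) :
    HeckeB Q q d →ₐ[K] (Module.End K (TensorSpace K n d))ᵐᵒᵖ :=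
  RingQuot.liftAlgHom K
    ⟨FreeAlgebra.lift K (fun t : Fin d => op (genAct Q q n t)), by
      intro x y h
      cases h with
      | braid i j hi hj =>
        simp only [map_mul, FreeAlgebra.lift_ι_apply, ← op_mul, ← mul_assoc]
        rw [genAct_braid Q q i j hi hj]
      | braid_zero i j hi hj =>
        simp only [map_mul, map_pow, FreeAlgebra.lift_ι_apply, ← op_mul, ← op_pow]
        rw [genAct_braid_zero Q q i j hi hj]
      | comm i j hij =>
        simp only [map_mul, FreeAlgebra.lift_ι_apply, ← op_mul]
        rw [genAct_comm Q q i j hij]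
      | quad_zero i hi =>
        simp only [map_add, map_smul, map_one, map_pow, FreeAlgebra.lift_ι_apply, ← op_pow]
        rw [genAct_quad_zero Q q i hi, MulOpposite.op_add, MulOpposite.op_smul,
          MulOpposite.op_one]
      | quad i hi =>
        simp only [map_add, map_smul, map_one, map_pow, FreeAlgebra.lift_ι_apply, ← op_pow]
        rw [genAct_quad Q q ⟨i.val - 1, by omega⟩ i (by simp; omega), MulOpposite.op_add, MulOpposite.op_smul,
          MulOpposite.op_one]⟩

/-- The tensor space as a right module over the Hecke algebra. -/
noncomputable instance (Q q : Kˣ) (n d : ℕ) :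
    Module (HeckeB Q q d)ᵐᵒᵖ (TensorSpace K n d) :=
  Module.compHom (TensorSpace K n d) (AlgHom.opComm (heckeAct Q q n d)).toRingHom

theorem op_smul_def (Q q : Kˣ) {n d : ℕ} (h : HeckeB Q q d) (v : TensorSpace K n d) :
    op h • v = (heckeAct Q q n d h).unop v := rfl

theorem op_T_smul (Q q : Kˣ) {n d : ℕ} (t : Fin d) (μ : Fin d → Idx n) :
    op (HeckeB.T Q q t) • tensorBasis K n d μ = basisAct Q q t μ := by
  rw [op_smul_def, HeckeB.T, heckeAct]
  erw [RingQuot.liftAlgHom_mkAlgHom_apply]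
  rw [FreeAlgebra.lift_ι_apply, unop_op, genAct, Module.Basis.constr_basis]

instance (Q q : Kˣ) (n d : ℕ) : SMulCommClass (HeckeB Q q d)ᵐᵒᵖ K (TensorSpace K n d) where
  smul_comm h c v := ((heckeAct Q q n d h.unop).unop.map_smul c v)

instance (Q q : Kˣ) (n d : ℕ) : SMulCommClass K (HeckeB Q q d)ᵐᵒᵖ (TensorSpace K n d) :=
  SMulCommClass.symm _ _ _

instance (Q q : Kˣ) (n d : ℕ) : IsScalarTower K (HeckeB Q q d)ᵐᵒᵖ (TensorSpace K n d) where
  smul_assoc c h v := by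
    change (heckeAct Q q n d (c • h.unop)).unop v = c • (heckeAct Q q n d h.unop).unop v
    rw [map_smul]
    rfl

/-- The `q`-Schur algebra of type B: the algebra of endomorphisms of the right module `V^{⊗d}`
over the Hecke algebra, acting on `V^{⊗d}` from the left. -/
abbrev SchurB (Q q : Kˣ) (n d : ℕ) : Type u :=
  Module.End (HeckeB Q q d)ᵐᵒᵖ (TensorSpace K n d)

end Action

/-- The corner `e A e` of a `K`-algebra is a `K`-algebra with unit `e`. -/
instance cornerAlgebra {K A : Type*} [CommSemiring K] [Ring A] [Algebra K A] {e : A}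
    (he : IsIdempotentElem e) : Algebra K he.Corner where
  smul c x := ⟨c • x.1, by
    obtain ⟨y, hy⟩ := x.2
    exact ⟨c • y, by rw [← hy]; simp⟩⟩
  algebraMap :=
    { toFun := fun c => ⟨c • e, ⟨c • e, by simp [he.eq]⟩⟩
      map_one' := Subtype.ext (one_smul K e)
      map_mul' := fun a b => Subtype.ext (by
        change (a * b) • e = (a • e) * (b • e)
        rw [smul_mul_smul_comm, he.eq])
      map_zero' := Subtype.ext (zero_smul K e)
      map_add' := fun a b => Subtype.ext (add_smul a b e) }
  commutes' c x := Subtype.ext (by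
    have h := (Subsemigroup.mem_corner_iff he).1 x.2
    change (c • e) * x.1 = x.1 * (c • e)
    rw [smul_mul_assoc, mul_smul_comm, h.1, h.2])
  smul_def' c x := Subtype.ext (by
    have h := (Subsemigroup.mem_corner_iff he).1 x.2
    change c • x.1 = (c • e) * x.1
    rw [smul_mul_assoc, h.1])

/-- The additive group `e M` for an element `e` of a ring and a left module `M`. -/
def idemPart {A : Type*} [Ring A] (e : A) (M : Type*) [AddCommGroup M] [Module A M] :
    AddSubgroup M :=
  (DistribSMul.toAddMonoidHom M e).range

end TypeB

/-
Since `d ≤ ⌊n/2⌋`, the tensor `v_1 ⊗ ⋯ ⊗ v_d` has a regular orbit `{v_w}` under the group of signed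
permutations, and `v_w = (v_1 ⊗ ⋯ ⊗ v_d) T_w`. The Hecke algebra is spanned by `2 ^ d * d!`
elements, one for each point of the orbit, so the span of the orbit is a free module of rank one.
Let `J` send `v_w` to `v_{w⁻¹}` and all other basis vectors to `0`. It exchanges the right action
of `T_t` on this regular module with the left one, so `e = J ^ 2`, the projection to the span of
the orbit, and `J T_t J` lie in the Schur algebra. Through `e` the orbit is a direct summand of the
tensor space: there is a linear form `β` with values in the Hecke algebra and
`e w = (v_1 ⊗ ⋯ ⊗ v_d) β(w)`. The rank one maps `w ↦ v β(w)` then identify `S e` with the tensor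
space and `e S e` with the Hecke algebra, such that `T_t` corresponds to `J T_t J`. The matrices of
`e` and `J T_t J` are symmetric, hence transposition induces on `e S e` the anti-automorphism that
fixes the generators.
-/

namespace TypeB

section Spanning

variable {K A : Type*} [CommSemiring K] [Semiring A] [Algebra K A] {T : ℕ → A} {p : ℕ}

/-- Elements `T_0, …, T_{d-1}` of a `K`-algebra that satisfy the braid relations of type B and
quadratic relations with arbitrary parameters. Indexing by `ℕ` keeps index arithmetic simple; the
values beyond `d` are irrelevant. -/
structure IsHeckeFamily (K : Type*) {A : Type*} [CommSemiring K] [Semiring A] [Algebra K A]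
    (T : ℕ → A) (d : ℕ) : Prop where
  comm : ∀ i j, i + 1 < j → j < d → T i * T j = T j * T i
  braid : ∀ i, 1 ≤ i → i + 1 < d → T i * T (i + 1) * T i = T (i + 1) * T i * T (i + 1)
  braid_zero : 1 < d → T 0 * T 1 * T 0 * T 1 = T 1 * T 0 * T 1 * T 0
  quad : ∀ i < d, ∃ c : K, T i * T i = c • T i + 1

/-- The product of the first `j` letters of `T_p, …, T_1, T_0, T_1, …, T_p`. For `j < 2 (p + 1)`
the corresponding elements of the Weyl group represent the right cosets of the parabolic subgroup
generated by the reflections `s_0, …, s_{p-1}`. The index `|p - j|` of the next letter is written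
as a sum of two truncated differences. -/
def cosetProd {A : Type*} [Monoid A] (T : ℕ → A) (p : ℕ) : ℕ → A
  | 0 => 1
  | j + 1 => cosetProd T p j * T ((p - j) + (j - p))

theorem cosetProd_succ {A : Type*} [Monoid A] {T : ℕ → A} {p j i : ℕ}
    (h : j + i = p ∨ j = p + i) :
    cosetProd T p (j + 1) = cosetProd T p j * T i := by
  rw [cosetProd, show (p - j) + (j - p) = i by omega]

namespace IsHeckeFamily

theorem mono {d e : ℕ} (h : IsHeckeFamily K T e) (hde : d ≤ e) : IsHeckeFamily K T d where
  comm i j hij hj := h.comm i j hij (by omega)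
  braid i hi hj := h.braid i hi (by omega)
  braid_zero hd := h.braid_zero (by omega)
  quad i hi := h.quad i (by omega)

theorem cosetProd_mul_of_add_lt (h : IsHeckeFamily K T (p + 1)) {t j : ℕ} (htj : t + j < p) :
    cosetProd T p j * T t = T t * cosetProd T p j := by
  induction j with
  | zero => simp [cosetProd]
  | succ j ih =>
    rw [cosetProd_succ (i := p - j) (by omega), mul_assoc, ← h.comm t (p - j) (by omega) (by omega),
      ← mul_assoc, ih (by omega), mul_assoc]

theorem cosetProd_mul_succ (h : IsHeckeFamily K T (p + 1)) {t j : ℕ} (htp : t < p)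
    (hpj : p < t + j) (hj : j ≤ p + t) :
    cosetProd T p j * T (t + 1) = T t * cosetProd T p j := by
  obtain ⟨m, rfl⟩ : ∃ m, j = p - (t + 1) + 1 + 1 + m := ⟨j - (p - (t + 1) + 1 + 1), by omega⟩
  induction m with
  | zero =>
    set i := p - (t + 1)
    calc cosetProd T p (i + 1 + 1) * T (t + 1)
        = cosetProd T p i * (T (t + 1) * T t * T (t + 1)) := by
          rw [cosetProd_succ (i := t) (by omega), cosetProd_succ (i := t + 1) (by omega)]
          simp only [mul_assoc]
      _ = cosetProd T p i * T t * T (t + 1) * T t := by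
          rw [← h.braid t (by omega) (by omega)]; simp only [mul_assoc]
      _ = T t * cosetProd T p (i + 1 + 1) := by
          rw [h.cosetProd_mul_of_add_lt (t := t) (by omega),
            cosetProd_succ (i := t) (by omega), cosetProd_succ (i := t + 1) (by omega)]
          simp only [mul_assoc]
  | succ m ih =>
    rw [← add_assoc, cosetProd, mul_assoc, h.comm _ (t + 1) (by omega) (by omega), ← mul_assoc,
      ih (by omega) (by omega), mul_assoc]

theorem cosetProd_mul_of_lt (h : IsHeckeFamily K T (p + 1)) {t j : ℕ} (htj : p + t + 1 < j)
    (hj : j ≤ 2 * p + 1) : cosetProd T p j * T t = T t * cosetProd T p j := by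
  obtain ⟨m, rfl⟩ : ∃ m, j = p + t + 1 + 1 + m := ⟨j - (p + t + 1 + 1), by omega⟩
  induction m with
  | zero =>
    rcases t with _ | t
    · obtain ⟨i, rfl⟩ : ∃ i, p = i + 1 := ⟨p - 1, by omega⟩
      have hc : cosetProd T (i + 1) (i + 1 + 1 + 1) = cosetProd T (i + 1) i * T 1 * T 0 * T 1 := by
        rw [cosetProd_succ (i := 1) (by omega), cosetProd_succ (i := 0) (by omega),
          cosetProd_succ (i := 1) (by omega)]
      calc cosetProd T (i + 1) (i + 1 + 1 + 1) * T 0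
          = cosetProd T (i + 1) i * (T 1 * T 0 * T 1 * T 0) := by rw [hc]; simp only [mul_assoc]
        _ = cosetProd T (i + 1) i * T 0 * T 1 * T 0 * T 1 := by
          rw [← h.braid_zero (by omega)]; simp only [mul_assoc]
        _ = T 0 * cosetProd T (i + 1) (i + 1 + 1 + 1) := by
          rw [h.cosetProd_mul_of_add_lt (t := 0) (by omega), hc]; simp only [mul_assoc]
    · set i := p + (t + 1)
      have hc : cosetProd T p (i + 1 + 1) = cosetProd T p i * T (t + 1) * T (t + 1 + 1) := by
        rw [cosetProd_succ (i := t + 1 + 1) (by omega), cosetProd_succ (i := t + 1) (by omega)]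
      calc cosetProd T p (i + 1 + 1) * T (t + 1)
          = cosetProd T p i * (T (t + 1) * T (t + 1 + 1) * T (t + 1)) := by
            rw [hc]; simp only [mul_assoc]
        _ = cosetProd T p i * T (t + 1 + 1) * T (t + 1) * T (t + 1 + 1) := by
          rw [h.braid (t + 1) (by omega) (by omega)]; simp only [mul_assoc]
        _ = T (t + 1) * cosetProd T p (i + 1 + 1) := by
          rw [h.cosetProd_mul_succ (by omega) (by omega) (by omega), hc]; simp only [mul_assoc]
  | succ m ih =>
    rw [← add_assoc, cosetProd, mul_assoc, ← h.comm t _ (by omega) (by omega), ← mul_assoc,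
      ih (by omega) (by omega), mul_assoc]

/-- The analogue of Deodhar's lemma on minimal coset representatives. -/
theorem cosetProd_mul (h : IsHeckeFamily K T (p + 1)) {t j : ℕ} (ht : t < p + 1)
    (hj : j < 2 * (p + 1)) :
    (∃ s < p, cosetProd T p j * T t = T s * cosetProd T p j) ∨
      (∃ i < 2 * (p + 1), cosetProd T p j * T t = cosetProd T p i) ∨
      ∃ i < 2 * (p + 1), ∃ c : K,
        cosetProd T p j * T t = c • cosetProd T p j + cosetProd T p i := by
  have up (hjt : j + t = p ∨ j = p + t) :
      ∃ i < 2 * (p + 1), cosetProd T p j * T t = cosetProd T p i :=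
    ⟨j + 1, by omega, (cosetProd_succ hjt).symm⟩
  have down (hjt : j + t = p + 1 ∨ j = p + t + 1) : ∃ i < 2 * (p + 1), ∃ c : K,
      cosetProd T p j * T t = c • cosetProd T p j + cosetProd T p i := by
    obtain ⟨i, rfl⟩ : ∃ i, j = i + 1 := ⟨j - 1, by omega⟩
    obtain ⟨c, hc⟩ := h.quad t ht
    refine ⟨i, by omega, c, ?_⟩
    rw [cosetProd_succ (i := t) (by omega), mul_assoc, hc, mul_add, mul_one, mul_smul_comm]
  rcases lt_trichotomy (j + t) p with hjt | hjt | hjt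
  · exact .inl ⟨t, by omega, h.cosetProd_mul_of_add_lt (by omega)⟩
  · exact .inr (.inl (up (.inl hjt)))
  rcases Nat.eq_or_lt_of_le (Nat.succ_le_of_lt hjt) with hjt | hjt
  · exact .inr (.inr (down (.inl hjt.symm)))
  rcases lt_trichotomy j (p + t) with hjt' | hjt' | hjt'
  · obtain ⟨s, rfl⟩ : ∃ s, t = s + 1 := ⟨t - 1, by omega⟩
    exact .inl ⟨s, by omega, h.cosetProd_mul_succ (by omega) (by omega) (by omega)⟩
  · exact .inr (.inl (up (.inr hjt')))
  rcases Nat.eq_or_lt_of_le (Nat.succ_le_of_lt hjt') with hjt' | hjt'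
  · exact .inr (.inr (down (.inr hjt'.symm)))
  · exact .inl ⟨t, by omega, h.cosetProd_mul_of_lt hjt' (by omega)⟩

theorem mul_mem_mul_span_cosetProd (h : IsHeckeFamily K T (p + 1)) {N : Submodule K A}
    (hN : ∀ t < p, ∀ x ∈ N, x * T t ∈ N) {t : ℕ} (ht : t < p + 1) {z : A}
    (hz : z ∈ N * Submodule.span K (cosetProd T p '' Set.Iio (2 * (p + 1)))) :
    z * T t ∈ N * Submodule.span K (cosetProd T p '' Set.Iio (2 * (p + 1))) := by
  set C := Submodule.span K (cosetProd T p '' Set.Iio (2 * (p + 1)))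
  have hC {j : ℕ} (hj : j < 2 * (p + 1)) : cosetProd T p j ∈ C :=
    Submodule.subset_span ⟨j, hj, rfl⟩
  induction hz using Submodule.mul_induction_on' with
  | add x _ y _ hx hy => rw [add_mul]; exact add_mem hx hy
  | mem_mul_mem x hx y hy =>
    rw [mul_assoc]
    induction hy using Submodule.span_induction with
    | zero => simp
    | add y z _ _ hy hz => rw [add_mul, mul_add]; exact add_mem hy hz
    | smul c y _ hy => rw [smul_mul_assoc, mul_smul_comm]; exact Submodule.smul_mem _ _ hy
    | mem y hy =>
      obtain ⟨j, hj, rfl⟩ := hy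
      obtain ⟨s, hs, e⟩ | ⟨i, hi, e⟩ | ⟨i, hi, c, e⟩ := h.cosetProd_mul ht hj <;> rw [e]
      · rw [← mul_assoc]
        exact Submodule.mul_mem_mul (hN s hs x hx) (hC hj)
      · exact Submodule.mul_mem_mul hx (hC hi)
      · exact Submodule.mul_mem_mul hx (add_mem (C.smul_mem c (hC hj)) (hC hi))

open scoped Pointwise Classical in
theorem exists_finset (d : ℕ) (h : IsHeckeFamily K T d) :
    ∃ B : Finset A, B.card ≤ 2 ^ d * d.factorial ∧ 1 ∈ Submodule.span K (B : Set A) ∧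
      ∀ t < d, ∀ x ∈ Submodule.span K (B : Set A), x * T t ∈ Submodule.span K (B : Set A) := by
  induction d with
  | zero => exact ⟨{1}, by simp, Submodule.subset_span (by simp), fun t ht => by omega⟩
  | succ p ih =>
    obtain ⟨B, hB, h1, hN⟩ := ih (h.mono (by omega))
    let C := (Finset.range (2 * (p + 1))).image (cosetProd T p)
    have hspan : Submodule.span K ((B * C : Finset A) : Set A) =
        Submodule.span K (B : Set A) *
          Submodule.span K (cosetProd T p '' Set.Iio (2 * (p + 1))) := by
      rw [Finset.coe_mul, Finset.coe_image, Finset.coe_range, Submodule.span_mul_span]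
    refine ⟨B * C, ?_, ?_, ?_⟩
    · calc (B * C).card ≤ B.card * C.card := Finset.card_mul_le
        _ ≤ (2 ^ p * p.factorial) * (2 * (p + 1)) :=
          Nat.mul_le_mul hB (Finset.card_image_le.trans (Finset.card_range _).le)
        _ = 2 ^ (p + 1) * (p + 1).factorial := by rw [Nat.factorial_succ]; ring
    · rw [hspan, ← mul_one (1 : A)]
      exact Submodule.mul_mem_mul h1
        (Submodule.subset_span ⟨0, Set.mem_Iio.2 (by omega), rfl⟩)
    · intro t ht x hx
      rw [hspan] at hx ⊢
      exact h.mul_mem_mul_span_cosetProd hN ht hx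

end IsHeckeFamily

end Spanning

section HeckeAlgebra

variable {K : Type u} [Field K] (Q q : Kˣ) {d : ℕ}

/-- The parameter `c` in the quadratic relation `T_t ^ 2 = c T_t + 1`. -/
def quadCoeff (t : Fin d) : K := if t.val = 0 then (↑Q⁻¹ : K) - (Q : K) else (↑q⁻¹ : K) - (q : K)

theorem quadCoeff_congr {t u : Fin d} (h : t.val = 0 ↔ u.val = 0) :
    quadCoeff Q q t = quadCoeff Q q u := by
  simp only [quadCoeff, h]

namespace HeckeB

theorem adjoin_T : Algebra.adjoin K (Set.range (T Q q (d := d))) = ⊤ := by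
  have hs : Function.Surjective (RingQuot.mkAlgHom K (HeckeRel Q q d)) :=
    RingQuot.mkAlgHom_surjective K _
  have h := congrArg (Subalgebra.map (RingQuot.mkAlgHom K (HeckeRel Q q d)))
    (FreeAlgebra.adjoin_range_ι K (Fin d))
  rwa [AlgHom.map_adjoin, ← Set.range_comp, Algebra.map_top, (AlgHom.range_eq_top _).2 hs] at h

theorem algHom_ext {A : Type*} [Semiring A] [Algebra K A] {f g : HeckeB Q q d →ₐ[K] A}
    (h : ∀ t, f (T Q q t) = g (T Q q t)) : f = g :=
  AlgHom.ext_of_adjoin_eq_top (adjoin_T Q q) (Set.eqOn_range.2 (funext h))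

variable {Q q} in
@[elab_as_elim]
theorem induction {P : HeckeB Q q d → Prop} (T : ∀ t, P (T Q q t))
    (algebraMap : ∀ c : K, P (algebraMap K _ c)) (add : ∀ x y, P x → P y → P (x + y))
    (mul : ∀ x y, P x → P y → P (x * y)) (x : HeckeB Q q d) : P x := by
  have hx : x ∈ Algebra.adjoin K (Set.range (HeckeB.T Q q (d := d))) := by
    rw [adjoin_T]; trivial
  induction hx using Algebra.adjoin_induction with
  | mem x hx => obtain ⟨t, rfl⟩ := hx; exact T t
  | algebraMap c => exact algebraMap c
  | add x y _ _ hx hy => exact add x y hx hy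
  | mul x y _ _ hx hy => exact mul x y hx hy

theorem T_braid {i j : Fin d} (hi : 1 ≤ i.val) (hj : j.val = i.val + 1) :
    T Q q i * T Q q j * T Q q i = T Q q j * T Q q i * T Q q j := by
  have h := RingQuot.mkAlgHom_rel K (HeckeRel.braid (Q := Q) (q := q) i j hi hj)
  simp only [map_mul] at h
  exact h

theorem T_braid_zero {i j : Fin d} (hi : i.val = 0) (hj : j.val = 1) :
    (T Q q i * T Q q j) ^ 2 = (T Q q j * T Q q i) ^ 2 := by
  have h := RingQuot.mkAlgHom_rel K (HeckeRel.braid_zero (Q := Q) (q := q) i j hi hj)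
  simp only [map_mul, map_pow] at h
  exact h

theorem T_comm {i j : Fin d} (hij : i.val + 1 < j.val) :
    T Q q i * T Q q j = T Q q j * T Q q i := by
  have h := RingQuot.mkAlgHom_rel K (HeckeRel.comm (Q := Q) (q := q) i j hij)
  simp only [map_mul] at h
  exact h

theorem T_sq (i : Fin d) : T Q q i ^ 2 = quadCoeff Q q i • T Q q i + 1 := by
  rw [quadCoeff]
  split_ifs with hi
  · have h := RingQuot.mkAlgHom_rel K (HeckeRel.quad_zero (Q := Q) (q := q) i hi)
    simp only [map_add, map_smul, map_one, map_pow] at h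
    exact h
  · have h := RingQuot.mkAlgHom_rel K (HeckeRel.quad (Q := Q) (q := q) i (by omega))
    simp only [map_add, map_smul, map_one, map_pow] at h
    exact h

theorem isHeckeFamily :
    IsHeckeFamily K (fun i => if h : i < d then T Q q (⟨i, h⟩ : Fin d) else 0) d where
  comm i j hij hj := by
    simp only [hj, show i < d by omega, dif_pos]
    exact T_comm Q q hij
  braid i hi hj := by
    simp only [hj, show i < d by omega, dif_pos]
    exact T_braid Q q hi rfl
  braid_zero hd := by
    simp only [hd, show 0 < d by omega, dif_pos]
    simpa only [pow_two, mul_assoc] using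
      T_braid_zero Q q (i := ⟨0, by omega⟩) (j := ⟨1, hd⟩) rfl rfl
  quad i hi := by
    simp only [hi, dif_pos, ← pow_two]
    exact ⟨_, T_sq Q q ⟨i, hi⟩⟩

theorem exists_span_eq_top : ∃ B : Finset (HeckeB Q q d), B.card ≤ 2 ^ d * d.factorial ∧
    Submodule.span K (B : Set (HeckeB Q q d)) = ⊤ := by
  obtain ⟨B, hB, h1, hmul⟩ := (isHeckeFamily Q q (d := d)).exists_finset
  set N := Submodule.span K (B : Set (HeckeB Q q d))
  refine ⟨B, hB, Submodule.eq_top_iff'.2 fun x => ?_⟩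
  suffices ∀ y ∈ N, y * x ∈ N by simpa only [one_mul] using this 1 h1
  induction x using HeckeB.induction with
  | T t => intro y hy; simpa only [t.2, dif_pos] using hmul t t.2 y hy
  | algebraMap c =>
    intro y hy
    rw [← Algebra.commutes, ← Algebra.smul_def]
    exact N.smul_mem c hy
  | add x z hx hz => intro y hy; rw [mul_add]; exact add_mem (hx y hy) (hz y hy)
  | mul x z hx hz => intro y hy; rw [← mul_assoc]; exact hz _ (hx y hy)

instance finite : Module.Finite K (HeckeB Q q d) := by
  obtain ⟨B, -, hB⟩ := exists_span_eq_top Q q (d := d)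
  exact ⟨⟨B, hB⟩⟩

theorem finrank_le : Module.finrank K (HeckeB Q q d) ≤ 2 ^ d * d.factorial := by
  obtain ⟨B, hcard, hB⟩ := exists_span_eq_top Q q (d := d)
  have h := finrank_span_finset_le_card (R := K) B
  rw [Set.finrank, hB, finrank_top] at h
  exact h.trans hcard

/-- The anti-automorphism of the Hecke algebra that fixes the generators, as a homomorphism to the
opposite algebra. -/
noncomputable def antiHom (d : ℕ) : HeckeB Q q d →ₐ[K] (HeckeB Q q d)ᵐᵒᵖ :=
  RingQuot.liftAlgHom K
    ⟨FreeAlgebra.lift K (fun t : Fin d => op (T Q q t)), by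
      intro x y h
      cases h with
      | braid i j hi hj =>
        simp only [map_mul, FreeAlgebra.lift_ι_apply, ← op_mul, ← mul_assoc, T_braid Q q hi hj]
      | braid_zero i j hi hj =>
        simp only [map_mul, map_pow, FreeAlgebra.lift_ι_apply, ← op_mul, ← op_pow,
          T_braid_zero Q q hi hj]
      | comm i j hij =>
        simp only [map_mul, FreeAlgebra.lift_ι_apply, ← op_mul, T_comm Q q hij]
      | quad_zero i hi =>
        simp only [map_add, map_smul, map_one, map_pow, FreeAlgebra.lift_ι_apply, ← op_pow,
          T_sq, quadCoeff, if_pos hi, op_add, op_smul, op_one]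
      | quad i hi =>
        simp only [map_add, map_smul, map_one, map_pow, FreeAlgebra.lift_ι_apply, ← op_pow,
          T_sq, quadCoeff, if_neg (show i.val ≠ 0 by omega), op_add, op_smul, op_one]⟩

theorem antiHom_T (t : Fin d) : antiHom Q q d (T Q q t) = op (T Q q t) :=
  (RingQuot.liftAlgHom_mkAlgHom_apply K _ _ _).trans (FreeAlgebra.lift_ι_apply _ _)

theorem opComm_antiHom_comp_antiHom :
    (AlgHom.opComm (antiHom Q q d)).comp (antiHom Q q d) = AlgHom.id K _ :=
  algHom_ext Q q fun t => by simp [antiHom_T]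

/-- The anti-automorphism of the Hecke algebra that fixes the generators. -/
noncomputable def anti (d : ℕ) : HeckeB Q q d ≃ₐ[K] (HeckeB Q q d)ᵐᵒᵖ :=
  AlgEquiv.ofAlgHom (antiHom Q q d) (AlgHom.opComm (antiHom Q q d))
    (AlgHom.ext fun x =>
      unop_injective (DFunLike.congr_fun (opComm_antiHom_comp_antiHom Q q) x.unop))
    (opComm_antiHom_comp_antiHom Q q)

theorem anti_T (t : Fin d) : anti Q q d (T Q q t) = op (T Q q t) := antiHom_T Q q t

end HeckeB

end HeckeAlgebra

section RankOne

variable {K H V : Type*} [CommSemiring K] [Ring H] [Algebra K H] [AddCommGroup V] [Module K V]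
  [Module Hᵐᵒᵖ V] [SMulCommClass Hᵐᵒᵖ K V] [IsScalarTower K Hᵐᵒᵖ V]

/-- The endomorphism `w ↦ v β(w)` of a right module attached to an `H`-valued linear form `β` and
a vector `v`, as a function of `v` that is linear over the endomorphism ring. -/
def rankOne (β : V →ₗ[Hᵐᵒᵖ] H) : V →ₗ[Module.End Hᵐᵒᵖ V] Module.End Hᵐᵒᵖ V where
  toFun v :=
    { toFun w := op (β w) • v
      map_add' w w' := by rw [map_add, op_add, add_smul]
      map_smul' h w := by
        rw [map_smul, RingHom.id_apply, ← mul_smul, ← op_unop h, op_smul_eq_mul, op_mul] }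
  map_add' v v' := LinearMap.ext fun w => smul_add _ v v'
  map_smul' s v := LinearMap.ext fun w => (map_smul s _ v).symm

variable (β : V →ₗ[Hᵐᵒᵖ] H) (v₀ : V)

theorem rankOne_apply (v w : V) : rankOne β v w = op (β w) • v := rfl

theorem mul_rankOne (s : Module.End Hᵐᵒᵖ V) (v : V) : s * rankOne β v = rankOne β (s v) :=
  ((rankOne β).map_smul s v).symm

variable {β v₀}

theorem rankOne_apply_base_of_mul_eq {s : Module.End Hᵐᵒᵖ V} (hs : s * rankOne β v₀ = s) :
    rankOne β (s v₀) = s := by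
  rw [← mul_rankOne, hs]

variable (hβ : β v₀ = 1)
include hβ

theorem rankOne_base (v : V) : rankOne β v v₀ = v := by
  rw [rankOne_apply, hβ, op_one, one_smul]

theorem rankOne_mul_rankOne_base (v : V) : rankOne β v * rankOne β v₀ = rankOne β v := by
  rw [mul_rankOne, rankOne_base hβ]

theorem isIdempotentElem_rankOne : IsIdempotentElem (rankOne β v₀) :=
  rankOne_mul_rankOne_base hβ v₀

theorem rankOne_mul_rankOne_smul_base (v : V) (h : H) :
    rankOne β v * rankOne β (op h • v₀) = rankOne β (op h • v) := by
  rw [mul_rankOne, map_smul, rankOne_base hβ]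

/-- If `β(v₀) = 1` and `e` is the idempotent `w ↦ v₀ β(w)`, then the corner `e End(V) e` is
isomorphic to the algebra acting on `V`. -/
def cornerEquiv : (isIdempotentElem_rankOne hβ).Corner ≃ₐ[K] H where
  toFun f := β (f.1 v₀)
  invFun h := ⟨rankOne β (op h • v₀), (Subsemigroup.mem_corner_iff
    (isIdempotentElem_rankOne hβ)).2
      ⟨rankOne_mul_rankOne_smul_base hβ v₀ h, rankOne_mul_rankOne_base hβ _⟩⟩
  left_inv f := by
    obtain ⟨hl, hr⟩ := (Subsemigroup.mem_corner_iff (isIdempotentElem_rankOne hβ)).1 f.2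
    refine Subtype.ext ?_
    change rankOne β (rankOne β v₀ (f.1 v₀)) = f.1
    rw [← Module.End.mul_apply, hl, rankOne_apply_base_of_mul_eq hr]
  right_inv h := by
    change β (rankOne β (op h • v₀) v₀) = h
    rw [rankOne_base hβ, map_smul, hβ, op_smul_eq_mul, one_mul]
  map_mul' f g := by
    obtain ⟨hl, -⟩ := (Subsemigroup.mem_corner_iff (isIdempotentElem_rankOne hβ)).1 g.2
    have hg : g.1 v₀ = op (β (g.1 v₀)) • v₀ := by
      rw [← rankOne_apply, ← Module.End.mul_apply, hl]
    calc β (f.1 (g.1 v₀)) = β (f.1 (op (β (g.1 v₀)) • v₀)) := by rw [← hg]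
      _ = β (f.1 v₀) * β (g.1 v₀) := by rw [map_smul, map_smul, op_smul_eq_mul]
  map_add' f g := map_add β (f.1 v₀) (g.1 v₀)
  commutes' c := by
    change β (c • rankOne β v₀ v₀) = _
    rw [rankOne_base hβ, LinearMap.map_smul_of_tower, hβ, Algebra.algebraMap_eq_smul_one]

theorem cornerEquiv_symm_apply (h : H) :
    ((cornerEquiv (K := K) hβ).symm h).1 = rankOne β (op h • v₀) := rfl

/-- The isomorphism `v ↦ (w ↦ v β(w))` from `V` to the left ideal `End(V) e`. -/
def leftIdealEquiv :
    V ≃ₗ[Module.End Hᵐᵒᵖ V] Submodule.span (Module.End Hᵐᵒᵖ V) {rankOne β v₀} where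
  __ := (rankOne β).codRestrict _ fun v =>
    Submodule.mem_span_singleton.2 ⟨rankOne β v, rankOne_mul_rankOne_base hβ v⟩
  invFun s := s.1 v₀
  left_inv v := rankOne_base hβ v
  right_inv s := by
    obtain ⟨x, hx⟩ := Submodule.mem_span_singleton.1 s.2
    refine Subtype.ext (rankOne_apply_base_of_mul_eq ?_)
    rw [← hx, smul_eq_mul, mul_assoc, (isIdempotentElem_rankOne hβ).eq]

theorem leftIdealEquiv_smul (v : V) (h : H) :
    (leftIdealEquiv hβ (op h • v)).1 =
      (leftIdealEquiv hβ v).1 * ((cornerEquiv (K := K) hβ).symm h).1 :=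
  (rankOne_mul_rankOne_smul_base hβ v h).symm

variable {τ : Module.End Hᵐᵒᵖ V ≃ₐ[K] (Module.End Hᵐᵒᵖ V)ᵐᵒᵖ}
  (hτ : τ (rankOne β v₀) = op (rankOne β v₀))

/-- The isomorphism from `V` to the right ideal `e End(V)` induced by an anti-automorphism of
`End(V)` that fixes `e`. -/
def rightIdealEquiv : V ≃+ Submodule.span (Module.End Hᵐᵒᵖ V)ᵐᵒᵖ {rankOne β v₀} where
  toFun v := ⟨(τ (rankOne β v)).unop, Submodule.mem_span_singleton.2 ⟨τ (rankOne β v), by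
    rw [← op_unop (τ (rankOne β v)), op_smul_eq_mul, unop_op, ← unop_op (rankOne β v₀), ← hτ,
      ← unop_mul, ← map_mul, rankOne_mul_rankOne_base hβ]⟩⟩
  invFun s := τ.symm (op s.1) v₀
  left_inv v := by
    change τ.symm (τ (rankOne β v)) v₀ = v
    rw [AlgEquiv.symm_apply_apply, rankOne_base hβ]
  right_inv s := by
    obtain ⟨x, hx⟩ := Submodule.mem_span_singleton.1 s.2
    have hs : τ.symm (op s.1) * rankOne β v₀ = τ.symm (op s.1) := by
      apply τ.injective
      rw [map_mul, AlgEquiv.apply_symm_apply, hτ, ← op_mul, ← hx, ← op_unop x, op_smul_eq_mul,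
        ← mul_assoc, (isIdempotentElem_rankOne hβ).eq]
    refine Subtype.ext ?_
    change (τ (rankOne β (τ.symm (op s.1) v₀))).unop = s.1
    rw [rankOne_apply_base_of_mul_eq hs, AlgEquiv.apply_symm_apply, unop_op]
  map_add' v w := Subtype.ext (by simp only [map_add, unop_add, AddMemClass.mk_add_mk])

theorem rightIdealEquiv_smul (s : Module.End Hᵐᵒᵖ V) (v : V) :
    (rightIdealEquiv hβ hτ (s • v)).1 = (rightIdealEquiv hβ hτ v).1 * (τ s).unop := by
  change (τ (rankOne β (s v))).unop = (τ (rankOne β v)).unop * (τ s).unop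
  rw [← mul_rankOne, map_mul, unop_mul]

theorem rightIdealEquiv_op_smul (v : V) (h : H) :
    (rightIdealEquiv hβ hτ (op h • v)).1 =
      (τ ((cornerEquiv (K := K) hβ).symm h).1).unop * (rightIdealEquiv hβ hτ v).1 := by
  change (τ (rankOne β (op h • v))).unop =
    (τ (rankOne β (op h • v₀))).unop * (τ (rankOne β v)).unop
  rw [← unop_mul, ← map_mul, rankOne_mul_rankOne_smul_base hβ]

include hτ in
theorem map_cornerEquiv_symm {σ : H ≃ₐ[K] Hᵐᵒᵖ} {X : Set H} (hX : Algebra.adjoin K X = ⊤)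
    (hσ : ∀ x ∈ X, τ ((cornerEquiv (K := K) hβ).symm x).1 =
      op ((cornerEquiv (K := K) hβ).symm (σ x).unop).1) (h : H) :
    τ ((cornerEquiv (K := K) hβ).symm h).1 = op ((cornerEquiv (K := K) hβ).symm (σ h).unop).1 := by
  set ρ := (cornerEquiv (K := K) hβ).symm
  have hadd (x y : H) : (ρ (x + y)).1 = (ρ x).1 + (ρ y).1 := congrArg Subtype.val (map_add ρ x y)
  have hmul (x y : H) : (ρ (x * y)).1 = (ρ x).1 * (ρ y).1 := congrArg Subtype.val (map_mul ρ x y)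
  have hscal (c : K) : (ρ (algebraMap K H c)).1 = c • rankOne β v₀ :=
    congrArg Subtype.val (ρ.commutes c)
  have hh : h ∈ Algebra.adjoin K X := hX ▸ Algebra.mem_top
  induction hh using Algebra.adjoin_induction with
  | mem x hx => exact hσ x hx
  | algebraMap c =>
    rw [σ.commutes, MulOpposite.algebraMap_apply, unop_op, hscal, map_smul, hτ, op_smul]
  | add x y _ _ hx hy => rw [hadd, map_add, hx, hy, map_add, unop_add, hadd, op_add]
  | mul x y _ _ hx hy => rw [hmul, map_mul, hx, hy, map_mul, unop_mul, hmul, op_mul]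

end RankOne

section SchurFunctor

open CategoryTheory

variable {A : Type*} [Ring A] {e : A} (he : IsIdempotentElem e)

include he in
theorem mem_idemPart_iff {M : Type*} [AddCommGroup M] [Module A M] {x : M} :
    x ∈ idemPart e M ↔ e • x = x := by
  constructor
  · rintro ⟨y, rfl⟩
    change e • e • y = e • y
    rw [← mul_smul, he.eq]
  · exact fun h => ⟨x, h⟩

/-- The action of the corner `e A e` on `e M`. -/
abbrev cornerModule (M : Type*) [AddCommGroup M] [Module A M] :
    Module he.Corner (idemPart e M) where
  smul a x := ⟨a.1 • x.1, by
    rw [mem_idemPart_iff he, ← mul_smul, ((Subsemigroup.mem_corner_iff he).1 a.2).1]⟩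
  one_smul x := Subtype.ext ((mem_idemPart_iff he).1 x.2)
  mul_smul a b x := Subtype.ext (mul_smul a.1 b.1 x.1)
  smul_zero a := Subtype.ext (smul_zero a.1)
  smul_add a x y := Subtype.ext (smul_add a.1 x.1 y.1)
  add_smul a b x := Subtype.ext (add_smul a.1 b.1 x.1)
  zero_smul x := Subtype.ext (zero_smul A x.1)

/-- The functor `M ↦ e M` from `A`-modules to modules over the corner `e A e`. -/
def cornerFunctor : ModuleCat.{w} A ⥤ ModuleCat.{w} he.Corner where
  obj M := letI := cornerModule he M; ModuleCat.of he.Corner (idemPart e M)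
  map {M N} f := letI := cornerModule he M; letI := cornerModule he N
    ModuleCat.ofHom
      { toFun x := ⟨f.hom x.1, by
          rw [mem_idemPart_iff he, ← map_smul, (mem_idemPart_iff he).1 x.2]⟩
        map_add' x y := Subtype.ext (map_add f.hom x.1 y.1)
        map_smul' a x := Subtype.ext (map_smul f.hom a.1 x.1) }

theorem exists_idemFunctor {H : Type*} [Ring H] (φ : H →+* he.Corner) :
    ∃ (F : ModuleCat.{w} A ⥤ ModuleCat.{w} H)
      (η : ∀ M : ModuleCat.{w} A, F.obj M ≃+ idemPart e M),
      (∀ (M : ModuleCat.{w} A) (h : H) (x : F.obj M),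
        (η M (h • x)).1 = (φ h).1 • (η M x).1) ∧
      (∀ (M N : ModuleCat.{w} A) (f : M ⟶ N) (x : F.obj M),
        (η N ((F.map f).hom x)).1 = f.hom (η M x).1) :=
  ⟨cornerFunctor he ⋙ ModuleCat.restrictScalars φ, fun M => AddEquiv.refl (idemPart e M),
    fun _ _ _ => rfl, fun _ _ _ _ => rfl⟩

end SchurFunctor

section Transpose

variable {K V ι : Type*} [CommSemiring K] [AddCommMonoid V] [Module K V] [Fintype ι] [DecidableEq ι]
  (b : Module.Basis ι K V)

/-- Transposition of endomorphisms with respect to a basis. -/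
noncomputable def transposeEnd : Module.End K V ≃ₐ[K] (Module.End K V)ᵐᵒᵖ :=
  (LinearMap.toMatrixAlgEquiv b).trans
    ((Matrix.transposeAlgEquiv ι K K).trans (AlgEquiv.op (LinearMap.toMatrixAlgEquiv b).symm))

theorem repr_transposeEnd (f : Module.End K V) (i j : ι) :
    b.repr ((transposeEnd b f).unop (b i)) j = b.repr (f (b j)) i := by
  have h : LinearMap.toMatrixAlgEquiv b (transposeEnd b f).unop =
      (LinearMap.toMatrixAlgEquiv b f).transpose :=
    (LinearMap.toMatrixAlgEquiv b).apply_symm_apply _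
  simpa only [LinearMap.toMatrixAlgEquiv_apply, Matrix.transpose_apply] using
    congrFun (congrFun h j) i

theorem transposeEnd_eq_op_iff {f g : Module.End K V} :
    transposeEnd b f = op g ↔ ∀ i j, b.repr (f (b i)) j = b.repr (g (b j)) i := by
  rw [← unop_inj, unop_op]
  refine ⟨fun h i j => by rw [← h, repr_transposeEnd], fun h => ?_⟩
  refine b.ext fun j => b.repr.injective (Finsupp.ext fun i => ?_)
  rw [repr_transposeEnd, h]

theorem unop_transposeEnd_unop_transposeEnd (f : Module.End K V) :
    (transposeEnd b (transposeEnd b f).unop).unop = f :=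
  congrArg unop ((transposeEnd_eq_op_iff b).2 (repr_transposeEnd b f))

theorem transposeEnd_eq_op_of_involutive {A : Module.End K V} {s : ι → ι} {a c : ι → K}
    (hs : Function.Involutive s) (ha : ∀ i, a (s i) = a i)
    (hA : ∀ i, A (b i) = a i • b (s i) + c i • b i) : transposeEnd b A = op A := by
  refine (transposeEnd_eq_op_iff b).2 fun i j => ?_
  rw [hA, hA]
  simp only [map_add, map_smul, Module.Basis.repr_self, Finsupp.add_apply, Finsupp.smul_apply,
    smul_eq_mul, Finsupp.single_apply]
  congr 1
  · by_cases h : s i = j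
    · rw [if_pos h, if_pos (hs.eq_iff.1 h).symm, ← h, ha]
    · rw [if_neg h, if_neg fun h' => h (hs.eq_iff.1 h').symm, mul_zero, mul_zero]
  · by_cases h : i = j
    · rw [h]
    · rw [if_neg h, if_neg (Ne.symm h), mul_zero, mul_zero]

end Transpose

section SchurTranspose

variable {K : Type u} [Field K] (Q q : Kˣ) {n d : ℕ}

theorem placeAct_involutive (t : Fin d) :
    Function.Involutive (placeAct t : (Fin d → Idx n) → Fin d → Idx n) := by
  intro μ
  unfold placeAct
  split_ifs with h
  · simp [Idx.neg_neg]
  · exact comp_swap_swap _ _ _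

theorem op_T_smul_eq (t : Fin d) (v : TensorSpace K n d) :
    op (HeckeB.T Q q t) • v = genAct Q q n t v := by
  have h : (heckeAct Q q n d (HeckeB.T Q q t)).unop = genAct Q q n t :=
    (tensorBasis K n d).ext fun μ => by
      rw [← op_smul_def, op_T_smul, genAct, Module.Basis.constr_basis]
  rw [op_smul_def, h]

/-- The coefficient of `v_{μ s_t}` in `v_μ T_t`. -/
noncomputable def swapCoeff (t : Fin d) (μ : Fin d → Idx n) : K :=
  if t.val = 0 then (if 0 = (μ t).1 then (↑Q⁻¹ : K) else 1)
  else (if μ (prevPos t) = μ t then (↑q⁻¹ : K) else 1)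

/-- The coefficient of `v_μ` in `v_μ T_t`, for `μ ≠ μ s_t`. -/
noncomputable def diagCoeff (t : Fin d) (μ : Fin d → Idx n) : K :=
  if t.val = 0 then (if (μ t).1 < 0 then (↑Q⁻¹ : K) - (Q : K) else 0)
  else (if μ t < μ (prevPos t) then (↑q⁻¹ : K) - (q : K) else 0)

theorem genAct_basis (t : Fin d) (μ : Fin d → Idx n) :
    genAct Q q n t (tensorBasis K n d μ) =
      swapCoeff Q q t μ • tensorBasis K n d (placeAct t μ) +
        diagCoeff Q q t μ • tensorBasis K n d μ := by
  rw [genAct, Module.Basis.constr_basis, basisAct, swapCoeff, diagCoeff]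
  by_cases ht : t.val = 0
  · simp only [if_pos ht]
    rcases lt_trichotomy 0 (μ t).1 with h | h | h
    · rw [if_pos h, if_neg h.ne, if_neg h.asymm]; simp
    · rw [if_neg h.not_lt, if_pos h, if_pos h, if_neg h.symm.not_lt]; simp
    · rw [if_neg h.asymm, if_neg h.ne', if_neg h.ne', if_pos h]; simp
  · simp only [if_neg ht]
    rcases lt_trichotomy (μ (prevPos t)) (μ t) with h | h | h
    · rw [if_pos h, if_neg h.ne, if_neg h.asymm]; simp
    · rw [if_neg h.not_lt, if_pos h, if_pos h, if_neg h.symm.not_lt]; simp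
    · rw [if_neg h.asymm, if_neg h.ne', if_neg h.ne', if_pos h]; simp

theorem swapCoeff_placeAct (t : Fin d) (μ : Fin d → Idx n) :
    swapCoeff (K := K) Q q t (placeAct t μ) = swapCoeff Q q t μ := by
  unfold swapCoeff placeAct
  by_cases ht : t.val = 0
  · have h : 0 = (μ t).neg.1 ↔ 0 = (μ t).1 := by simp only [Idx.neg]; omega
    simp only [if_pos ht, Function.update_self, h]
  · simp only [if_neg ht, Function.comp_apply, Equiv.swap_apply_left, Equiv.swap_apply_right,
      eq_comm]

theorem transposeEnd_genAct (t : Fin d) :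
    transposeEnd (tensorBasis K n d) (genAct Q q n t) = op (genAct Q q n t) :=
  transposeEnd_eq_op_of_involutive _ (placeAct_involutive t) (swapCoeff_placeAct Q q t)
    (genAct_basis Q q t)

namespace SchurB

variable {Q q}

/-- A `K`-linear endomorphism of the tensor space that commutes with the generators of the Hecke
algebra, as an element of the Schur algebra. -/
noncomputable def ofCommute (f : Module.End K (TensorSpace K n d))
    (hf : ∀ t, Commute f (genAct Q q n t)) : SchurB Q q n d where
  toFun := f
  map_add' := f.map_add
  map_smul' h v := by
    obtain ⟨h, rfl⟩ := op_surjective h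
    rw [RingHom.id_apply]
    induction h using HeckeB.induction generalizing v with
    | T t => rw [op_T_smul_eq, op_T_smul_eq]; exact LinearMap.congr_fun (hf t).eq v
    | algebraMap c =>
      rw [← MulOpposite.algebraMap_apply, algebraMap_smul, algebraMap_smul, f.map_smul]
    | add x y hx hy => rw [op_add, add_smul, add_smul, f.map_add, hx, hy]
    | mul x y hx hy => rw [op_mul, mul_smul, mul_smul, hy, hx]

theorem ofCommute_apply (f : Module.End K (TensorSpace K n d))
    (hf : ∀ t, Commute f (genAct Q q n t)) (v : TensorSpace K n d) : ofCommute f hf v = f v := rfl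

variable (Q q n d) in
/-- The inclusion of the Schur algebra into the algebra of all `K`-linear endomorphisms. -/
noncomputable def toEnd : SchurB Q q n d →ₐ[K] Module.End K (TensorSpace K n d) where
  toFun s := s.restrictScalars K
  map_one' := rfl
  map_mul' _ _ := rfl
  map_zero' := rfl
  map_add' _ _ := rfl
  commutes' _ := rfl

theorem toEnd_injective : Function.Injective (toEnd Q q n d) :=
  LinearMap.restrictScalars_injective K

theorem toEnd_commute_genAct (s : SchurB Q q n d) (t : Fin d) :
    Commute (toEnd Q q n d s) (genAct Q q n t) := by
  refine LinearMap.ext fun v => ?_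
  change s (genAct Q q n t v) = genAct Q q n t (s v)
  rw [← op_T_smul_eq, ← op_T_smul_eq, map_smul]

/-- The transpose of an element of the Schur algebra with respect to the basis `v_μ`. -/
noncomputable def transpose (s : SchurB Q q n d) : SchurB Q q n d :=
  ofCommute (transposeEnd (tensorBasis K n d) (toEnd Q q n d s)).unop fun t => by
    rw [← commute_op, op_unop, ← transposeEnd_genAct]
    exact (toEnd_commute_genAct s t).map _

theorem toEnd_transpose (s : SchurB Q q n d) :
    toEnd Q q n d s.transpose = (transposeEnd (tensorBasis K n d) (toEnd Q q n d s)).unop := rfl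

theorem transpose_transpose (s : SchurB Q q n d) : s.transpose.transpose = s := by
  apply toEnd_injective
  rw [toEnd_transpose, toEnd_transpose, unop_transposeEnd_unop_transposeEnd]

variable (Q q n d) in
/-- Transposition as an anti-automorphism of the Schur algebra. -/
noncomputable def transposeEquiv : SchurB Q q n d ≃ₐ[K] (SchurB Q q n d)ᵐᵒᵖ where
  toFun s := op s.transpose
  invFun s := s.unop.transpose
  left_inv s := s.transpose_transpose
  right_inv s := unop_injective s.unop.transpose_transpose
  map_mul' s s' := unop_injective <| toEnd_injective <| by simp [toEnd_transpose]
  map_add' s s' := unop_injective <| toEnd_injective <| by simp [toEnd_transpose]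
  commutes' c := unop_injective <| toEnd_injective <| by
    simp [toEnd_transpose, MulOpposite.algebraMap_apply]

theorem repr_transposeEquiv (s : SchurB Q q n d) (μ ν : Fin d → Idx n) :
    (tensorBasis K n d).repr ((transposeEquiv Q q n d s).unop (tensorBasis K n d μ)) ν =
      (tensorBasis K n d).repr (s (tensorBasis K n d ν)) μ := by
  change (tensorBasis K n d).repr (toEnd Q q n d s.transpose (tensorBasis K n d μ)) ν = _
  rw [toEnd_transpose, repr_transposeEnd]
  rfl

theorem transposeEquiv_ofCommute {f : Module.End K (TensorSpace K n d)}
    (hf : ∀ t, Commute f (genAct Q q n t)) (hfT : transposeEnd (tensorBasis K n d) f = op f) :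
    transposeEquiv Q q n d (ofCommute f hf) = op (ofCommute f hf) :=
  unop_injective <| toEnd_injective <| congrArg unop hfT

end SchurB

end SchurTranspose

section WeylGroup

variable {d : ℕ}

/-- The letters `±1, …, ±d`. -/
abbrev Letter (d : ℕ) : Type := Idx (2 * d)

namespace Letter

theorem bounds (x : Letter d) : x.1 ≠ 0 ∧ -d ≤ x.1 ∧ x.1 ≤ d := by
  have h := x.2
  have h2 : ¬ Odd (2 * d) := by simp
  simp only [Finset.mem_filter, Finset.mem_Icc, h2, false_or] at h
  exact ⟨h.2, by omega, by omega⟩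

theorem neg_val (x : Letter d) : x.neg.1 = -x.1 := rfl

theorem neg_lt_neg_iff {x y : Letter d} : x.neg < y.neg ↔ y < x := by
  rw [← Subtype.coe_lt_coe, ← Subtype.coe_lt_coe, neg_val, neg_val, _root_.neg_lt_neg_iff]

theorem neg_ne_self (x : Letter d) : x.neg ≠ x := fun h => by
  have h1 := congrArg Subtype.val h
  have h2 := x.bounds
  rw [neg_val] at h1
  omega

theorem card : Fintype.card (Letter d) = 2 * d := by
  have h : (Finset.Icc (-((2 * d / 2 : ℕ) : ℤ)) ((2 * d / 2 : ℕ) : ℤ)).filter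
      (fun i => Odd (2 * d) ∨ i ≠ 0) = (Finset.Icc (-(d : ℤ)) d).erase 0 := by
    ext i
    simp [and_comm]
  rw [Fintype.card_coe, h, Finset.card_erase_of_mem (by simp), Int.card_Icc]
  omega

/-- The letter `u + 1`, which stands at the place `u`; places are counted from `0`. -/
def pos (u : Fin d) : Letter d := ⟨u.val + 1, by simp; omega⟩

/-- The letter to the left of `pos u`: the letter `u` if `0 < u`, and `-1` if `u = 0`. -/
def pred (u : Fin d) : Letter d := if u.val = 0 then (pos u).neg else pos (prevPos u)

theorem pos_val (u : Fin d) : (pos u).1 = u.val + 1 := rfl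

theorem pred_val (u : Fin d) : (pred u).1 = if u.val = 0 then -1 else (u.val : ℤ) := by
  unfold pred
  split_ifs with h
  · rw [neg_val, pos_val, h]; rfl
  · rw [pos_val, prevPos]; dsimp only; omega

theorem pred_lt_pos (u : Fin d) : pred u < pos u := by
  rw [← Subtype.coe_lt_coe, pred_val, pos_val]
  split_ifs <;> omega

theorem eq_pos_or_eq_neg_pos (x : Letter d) : ∃ i, x = pos i ∨ x = (pos i).neg := by
  have hx := x.bounds
  refine ⟨⟨x.1.natAbs - 1, by omega⟩, ?_⟩
  rw [Subtype.ext_iff, Subtype.ext_iff, neg_val, pos_val]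
  dsimp only
  omega

theorem eq_pred_or_eq_neg_pos_of_covBy {x y : Letter d} (h : x ⋖ y) :
    ∃ u, (x = pred u ∧ y = pos u) ∨ (x = (pos u).neg ∧ y = (pred u).neg) := by
  have hx := x.bounds
  have hy := y.bounds
  have hxy : x.1 < y.1 := h.1
  have hpred := @pred_val d
  rcases hy.1.lt_or_gt with hneg | hpos
  · let u : Fin d := ⟨(-x.1 - 1).toNat, by omega⟩
    have hu : (u.val : ℤ) = -x.1 - 1 := by simp only [u]; omega
    have h1 : x = (pos u).neg := Subtype.ext (by rw [neg_val, pos_val]; omega)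
    refine ⟨u, Or.inr ⟨h1, ?_⟩⟩
    have h2 := h.2 (c := (pred u).neg)
    rw [← Subtype.coe_lt_coe, ← Subtype.coe_lt_coe, neg_val, hpred] at h2
    refine Subtype.ext ?_
    rw [neg_val, hpred]
    split_ifs at * <;> omega
  · let u : Fin d := ⟨(y.1 - 1).toNat, by omega⟩
    have hu : (u.val : ℤ) = y.1 - 1 := by simp only [u]; omega
    have h1 : y = pos u := Subtype.ext (by rw [pos_val]; omega)
    refine ⟨u, Or.inl ⟨?_, h1⟩⟩
    have h2 := h.2 (c := pred u)
    rw [← Subtype.coe_lt_coe, ← Subtype.coe_lt_coe, hpred] at h2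
    refine Subtype.ext ?_
    rw [hpred]
    split_ifs at * <;> omega

end Letter

open Letter

variable (d) in
/-- The sign change as a permutation of the letters `±1, …, ±d`. -/
def negPerm : Equiv.Perm (Letter d) := Function.Involutive.toPerm Idx.neg Idx.neg_neg

variable (d) in
/-- The group of signed permutations: the permutations of the letters `±1, …, ±d` that commute
with the sign change. It is the Weyl group of type B. -/
abbrev SignedPerm : Subgroup (Equiv.Perm (Letter d)) := Subgroup.centralizer {negPerm d}

theorem cycleType_negPerm : (negPerm d).cycleType = Multiset.replicate d 2 := by
  have h : (negPerm d).cycleType = Multiset.replicate (negPerm d).cycleType.card 2 :=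
    Multiset.eq_replicate_card.2 fun n hn => Equiv.Perm.pow_prime_eq_one_iff.1
      (Equiv.ext fun x => by rw [sq]; exact Idx.neg_neg x) n hn
  have hsupp : (negPerm d).support = Finset.univ :=
    Finset.eq_univ_of_forall fun x => Equiv.Perm.mem_support.2 (neg_ne_self x)
  have hsum := (negPerm d).sum_cycleType
  rw [h, Multiset.sum_replicate, hsupp, Finset.card_univ, Letter.card, smul_eq_mul] at hsum
  rw [h]
  congr 1
  omega

namespace SignedPerm

variable (d) in
theorem card : Nat.card (SignedPerm d) = 2 ^ d * d.factorial := by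
  rw [Equiv.Perm.nat_card_centralizer, cycleType_negPerm, Letter.card, Multiset.sum_replicate,
    Multiset.prod_replicate, smul_eq_mul, mul_comm d, Nat.sub_self, Nat.factorial_zero, one_mul]
  rcases d.eq_zero_or_pos with rfl | hd
  · simp
  · simp [Multiset.toFinset_replicate, hd.ne', Multiset.count_replicate_self]

theorem smul_neg (w : SignedPerm d) (x : Letter d) : w • x.neg = (w • x).neg :=
  (Equiv.congr_fun (Subgroup.mem_centralizer_singleton_iff.1 w.2) x)

/-- The reflection that interchanges `a` with `b` and `-a` with `-b`, as a map. -/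
def reflFun (a b x : Letter d) : Letter d :=
  if x = a then b else if x = b then a else if x = a.neg then b.neg else
    if x = b.neg then a.neg else x

theorem reflFun_val (a b x : Letter d) : (reflFun a b x).1 =
    if x.1 = a.1 then b.1 else if x.1 = b.1 then a.1 else
      if x.1 = -a.1 then -b.1 else if x.1 = -b.1 then -a.1 else x.1 := by
  simp only [reflFun, Subtype.ext_iff, apply_ite Subtype.val, neg_val]

theorem reflFun_involutive (a b : Letter d) : Function.Involutive (reflFun a b) := fun x => by
  have ha := a.bounds
  have hb := b.bounds
  refine Subtype.ext ?_
  simp only [reflFun_val]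
  split_ifs <;> omega

theorem reflFun_neg (a b x : Letter d) : reflFun a b x.neg = (reflFun a b x).neg := by
  have ha := a.bounds
  have hb := b.bounds
  refine Subtype.ext ?_
  simp only [reflFun_val, neg_val]
  split_ifs <;> omega

/-- The reflection that interchanges `a` with `b` and `-a` with `-b`. -/
def refl (a b : Letter d) : SignedPerm d :=
  ⟨(reflFun_involutive a b).toPerm, Subgroup.mem_centralizer_singleton_iff.2 <|
    Equiv.ext fun x => reflFun_neg a b x⟩

theorem refl_smul (a b x : Letter d) : refl a b • x = reflFun a b x := rfl

theorem ext_smul {v w : SignedPerm d} (h : ∀ x : Letter d, (v • x).1 = (w • x).1) : v = w :=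
  eq_of_smul_eq_smul fun x => Subtype.ext (h x)

theorem refl_comm (a b : Letter d) : refl a b = refl b a :=
  ext_smul fun x => by
    simp only [refl_smul, reflFun_val]
    split_ifs <;> omega

theorem refl_neg_neg (a b : Letter d) : refl a.neg b.neg = refl a b :=
  ext_smul fun x => by
    have ha := a.bounds
    have hb := b.bounds
    simp only [refl_smul, reflFun_val, neg_val]
    split_ifs <;> omega

theorem refl_mul_self (a b : Letter d) : refl a b * refl a b = 1 :=
  eq_of_smul_eq_smul fun x : Letter d => by
    rw [mul_smul, one_smul]
    exact reflFun_involutive a b x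

theorem mul_refl (w : SignedPerm d) (a b : Letter d) :
    w * refl a b = refl (w • a) (w • b) * w :=
  eq_of_smul_eq_smul fun x : Letter d => by
    simp only [mul_smul, refl_smul, reflFun, ← smul_neg, smul_left_cancel_iff]
    split_ifs <;> rfl

/-- The simple reflection `s_u`. -/
def simpleRefl (u : Fin d) : SignedPerm d := refl (pred u) (pos u)

theorem simpleRefl_smul_pred (u : Fin d) : simpleRefl u • pred u = pos u := if_pos rfl

theorem simpleRefl_smul_pos (u : Fin d) : simpleRefl u • pos u = pred u := by
  rw [← simpleRefl_smul_pred, ← mul_smul, simpleRefl, refl_mul_self, one_smul]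

theorem simpleRefl_mul_self (u : Fin d) : simpleRefl u * simpleRefl u = 1 := refl_mul_self _ _

theorem simpleRefl_inv (u : Fin d) : (simpleRefl u)⁻¹ = simpleRefl u :=
  inv_eq_of_mul_eq_one_left (simpleRefl_mul_self u)

theorem simpleRefl_smul_val (u : Fin d) (x : Letter d) : (simpleRefl u • x).1 =
    if x.1 = (pred u).1 then (pos u).1 else if x.1 = (pos u).1 then (pred u).1 else
      if x.1 = -(pred u).1 then -(pos u).1 else if x.1 = -(pos u).1 then -(pred u).1 else x.1 :=
  reflFun_val _ _ _

theorem simpleRefl_smul_lt_self_iff (t : Fin d) (x : Letter d) :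
    simpleRefl t • x < x ↔ x = pos t ∨ x = (pred t).neg := by
  have h := simpleRefl_smul_val t x
  have h1 : (pred t).1 < (pos t).1 := pred_lt_pos t
  rw [← Subtype.coe_lt_coe, h, Subtype.ext_iff, Subtype.ext_iff, neg_val]
  rw [pred_val, pos_val] at *
  split_ifs at * <;> omega

theorem lt_simpleRefl_smul_iff (t : Fin d) (x : Letter d) :
    x < simpleRefl t • x ↔ x = pred t ∨ x = (pos t).neg := by
  have h := simpleRefl_smul_lt_self_iff t (simpleRefl t • x)
  rwa [← mul_smul, simpleRefl_mul_self, one_smul, smul_eq_iff_eq_inv_smul, smul_eq_iff_eq_inv_smul,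
    simpleRefl_inv, smul_neg, simpleRefl_smul_pos, simpleRefl_smul_pred] at h

theorem simpleRefl_smul_lt_iff {t : Fin d} {x y : Letter d} (h : simpleRefl t • x ≠ y) :
    simpleRefl t • x < simpleRefl t • y ↔ x < y := by
  have hx := simpleRefl_smul_val t x
  have hy := simpleRefl_smul_val t y
  rw [Ne, Subtype.ext_iff] at h
  rw [← Subtype.coe_lt_coe, ← Subtype.coe_lt_coe]
  have := x.bounds
  have := y.bounds
  rw [pred_val, pos_val] at *
  split_ifs at * <;> omega

theorem refl_simpleRefl_smul {t : Fin d} {x : Letter d} (h : simpleRefl t • x ≠ x) :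
    refl x (simpleRefl t • x) = simpleRefl t := by
  have hx : simpleRefl t • x < x ∨ x < simpleRefl t • x := h.lt_or_gt
  rw [simpleRefl_smul_lt_self_iff, lt_simpleRefl_smul_iff] at hx
  rcases hx with (rfl | rfl) | (rfl | rfl)
  · rw [simpleRefl_smul_pos, refl_comm, simpleRefl]
  · rw [smul_neg, simpleRefl_smul_pred, refl_neg_neg, simpleRefl]
  · rw [simpleRefl_smul_pred, simpleRefl]
  · rw [smul_neg, simpleRefl_smul_pos, refl_neg_neg, refl_comm, simpleRefl]

theorem eq_zero_of_simpleRefl_smul_eq_neg {t : Fin d} {x : Letter d}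
    (h : simpleRefl t • x = x.neg) : t.val = 0 := by
  have hx := simpleRefl_smul_val t x
  have h1 := x.bounds
  rw [h, neg_val, pred_val, pos_val] at hx
  split_ifs at hx <;> omega

/-- Position `u` is a descent of the word `w(-d), …, w(-1), w(1), …, w(d)`. -/
def Desc (u : Fin d) (w : SignedPerm d) : Prop := w • pos u < w • pred u

theorem smul_pred_ne_smul_pos (w : SignedPerm d) (u : Fin d) : w • pred u ≠ w • pos u :=
  (smul_left_cancel_iff w).not.2 (pred_lt_pos u).ne

theorem not_desc_iff {u : Fin d} {w : SignedPerm d} : ¬ Desc u w ↔ w • pred u < w • pos u := by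
  rw [Desc, not_lt, (smul_pred_ne_smul_pos w u).le_iff_lt]

theorem not_desc_one (u : Fin d) : ¬ Desc u 1 := (pred_lt_pos u).not_gt

theorem desc_mul_simpleRefl (u : Fin d) (w : SignedPerm d) :
    Desc u (w * simpleRefl u) ↔ ¬ Desc u w := by
  rw [not_desc_iff, Desc, mul_smul, mul_smul, simpleRefl_smul_pos, simpleRefl_smul_pred]

theorem desc_simpleRefl_mul {t u : Fin d} {w : SignedPerm d}
    (h : simpleRefl t * w ≠ w * simpleRefl u) : Desc u (simpleRefl t * w) ↔ Desc u w := by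
  rw [Desc, Desc, mul_smul, mul_smul]
  refine simpleRefl_smul_lt_iff fun h1 => h ?_
  have h2 : simpleRefl t • w • pos u ≠ w • pos u := h1 ▸ smul_pred_ne_smul_pos w u
  rw [simpleRefl, simpleRefl, mul_refl, refl_comm (w • pred u), ← h1, refl_simpleRefl_smul h2,
    simpleRefl]

theorem desc_inv_mul_simpleRefl {t u : Fin d} {w : SignedPerm d}
    (h : simpleRefl t * w ≠ w * simpleRefl u) : Desc t (w * simpleRefl u)⁻¹ ↔ Desc t w⁻¹ := by
  rw [mul_inv_rev, simpleRefl_inv]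
  refine desc_simpleRefl_mul fun h1 => h (inv_injective ?_)
  rw [mul_inv_rev, mul_inv_rev, simpleRefl_inv, simpleRefl_inv, h1]

theorem simpleRefl_mul_inv_comm {t u : Fin d} {w : SignedPerm d}
    (h : simpleRefl t * w = w * simpleRefl u) : simpleRefl u * w⁻¹ = w⁻¹ * simpleRefl t := by
  rw [eq_inv_mul_iff_mul_eq, ← mul_assoc, ← h, mul_inv_cancel_right]

theorem smul_pos_of_comm {t u : Fin d} {w : SignedPerm d}
    (h : simpleRefl t * w = w * simpleRefl u) : w • pos u = simpleRefl t • w • pred u := by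
  rw [← mul_smul, h, mul_smul, simpleRefl_smul_pred]

theorem desc_iff_of_comm {t u : Fin d} {w : SignedPerm d}
    (h : simpleRefl t * w = w * simpleRefl u) :
    Desc u w ↔ w • pred u = pos t ∨ w • pred u = (pred t).neg := by
  rw [Desc, smul_pos_of_comm h, simpleRefl_smul_lt_self_iff]

theorem desc_inv_iff_desc {t u : Fin d} {w : SignedPerm d}
    (h : simpleRefl t * w = w * simpleRefl u) : Desc t w⁻¹ ↔ Desc u w := by
  have h1 : w⁻¹ • pred t = pos u ↔ w • pred u = pos t := by
    rw [inv_smul_eq_iff, smul_pos_of_comm h, ← inv_smul_eq_iff, simpleRefl_inv,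
      simpleRefl_smul_pred, eq_comm]
  have h2 : w⁻¹ • pred t = (pred u).neg ↔ w • pred u = (pred t).neg := by
    rw [inv_smul_eq_iff, smul_neg, eq_comm, Function.Involutive.eq_iff Idx.neg_neg]
  rw [desc_iff_of_comm h, desc_iff_of_comm (simpleRefl_mul_inv_comm h), h1, h2]

theorem eq_zero_of_comm {t u : Fin d} {w : SignedPerm d}
    (h : simpleRefl t * w = w * simpleRefl u) (hu : u.val = 0) : t.val = 0 := by
  refine eq_zero_of_simpleRefl_smul_eq_neg (x := w • pred u) ?_
  rw [← smul_pos_of_comm h, ← smul_neg, pred, if_pos hu, Idx.neg_neg]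

theorem eq_zero_iff_of_comm {t u : Fin d} {w : SignedPerm d}
    (h : simpleRefl t * w = w * simpleRefl u) : t.val = 0 ↔ u.val = 0 :=
  ⟨eq_zero_of_comm (simpleRefl_mul_inv_comm h), eq_zero_of_comm h⟩

theorem eq_one_of_forall_not_desc {w : SignedPerm d} (h : ∀ u, ¬ Desc u w) : w = 1 := by
  have hlt : ∀ u, w • pred u < w • pos u := fun u => not_desc_iff.1 (h u)
  have hmono : StrictMono fun x : Letter d => w • x := by
    refine (strictMono_iff_forall_covBy _).2 fun x y hxy => ?_
    obtain ⟨u, ⟨rfl, rfl⟩ | ⟨rfl, rfl⟩⟩ := eq_pred_or_eq_neg_pos_of_covBy hxy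
    · exact hlt u
    · simpa only [smul_neg, neg_lt_neg_iff] using hlt u
  have hrange : Set.range (fun x : Letter d => w • x) = Set.range id := by
    rw [Set.range_id, (MulAction.surjective w).range_eq]
  exact eq_of_smul_eq_smul (congrFun ((hmono.range_inj strictMono_id).1 hrange))

/-- The word of a signed permutation, in the set of all words with the lexicographic order. -/
def word (w : SignedPerm d) : Lex (Letter d → Letter d) := toLex fun x => w • x

theorem simpleRefl_smul_of_lt {u : Fin d} {x : Letter d} (h : x < (pos u).neg) :
    simpleRefl u • x = x := by
  have hx : x.1 < (pos u).neg.1 := h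
  refine Subtype.ext ?_
  rw [simpleRefl_smul_val]
  rw [neg_val, pos_val] at *
  rw [pred_val]
  split_ifs <;> omega

theorem word_mul_simpleRefl_lt {u : Fin d} {w : SignedPerm d} (h : Desc u w) :
    word (w * simpleRefl u) < word w := by
  refine ⟨(pos u).neg, fun x hx => ?_, ?_⟩
  · change (w * simpleRefl u) • x = w • x
    rw [mul_smul, simpleRefl_smul_of_lt hx]
  · change (w * simpleRefl u) • (pos u).neg < w • (pos u).neg
    rw [mul_smul, smul_neg, smul_neg, smul_neg, simpleRefl_smul_pos, neg_lt_neg_iff]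
    exact h

@[elab_as_elim]
theorem induction {P : SignedPerm d → Prop} (one : P 1)
    (mul_simpleRefl : ∀ w u, ¬ Desc u w → P w → P (w * simpleRefl u)) (w : SignedPerm d) : P w := by
  induction w using (InvImage.wf word wellFounded_lt).induction with
  | _ w ih =>
    by_cases h : ∃ u, Desc u w
    · obtain ⟨u, hu⟩ := h
      have h1 := mul_simpleRefl (w * simpleRefl u) u (by rwa [desc_mul_simpleRefl, not_not])
        (ih _ (word_mul_simpleRefl_lt hu))
      rwa [mul_assoc, simpleRefl_mul_self, mul_one] at h1
    · rw [eq_one_of_forall_not_desc (not_exists.1 h)]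
      exact one

theorem simpleRefl_smul_pos_eq (u i : Fin d) : simpleRefl u • pos i =
    if u.val = 0 then (if i = u then (pos u).neg else pos i)
    else pos (Equiv.swap (prevPos u) u i) := by
  refine Subtype.ext ?_
  rw [simpleRefl_smul_val]
  simp only [apply_ite Subtype.val, neg_val, pos_val, pred_val, Equiv.swap_apply_def, Fin.ext_iff,
    apply_ite Fin.val, prevPos]
  split_ifs <;> omega

end SignedPerm

end WeylGroup

section Orbit

variable {K : Type u} [Field K] (Q q : Kˣ) {n d : ℕ} (hd : d ≤ n / 2)

namespace SignedPerm

/-- The multi-index `(w(1), …, w(d))` of a signed permutation `w`. -/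
def toIdx (w : SignedPerm d) (i : Fin d) : Idx n :=
  ⟨(w • Letter.pos i).1, by
    have h := (w • Letter.pos i).bounds
    simp only [Finset.mem_filter, Finset.mem_Icc]
    exact ⟨⟨by omega, by omega⟩, Or.inr h.1⟩⟩

theorem toIdx_injective : Function.Injective (toIdx hd : SignedPerm d → Fin d → Idx n) := by
  intro v w h
  have hpos : ∀ i, v • Letter.pos i = w • Letter.pos i := fun i =>
    Subtype.ext (congrArg (fun μ : Fin d → Idx n => (μ i).1) h)
  refine eq_of_smul_eq_smul fun x : Letter d => ?_
  obtain ⟨i, rfl | rfl⟩ := x.eq_pos_or_eq_neg_pos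
  · exact hpos i
  · rw [SignedPerm.smul_neg, SignedPerm.smul_neg, hpos]

theorem placeAct_toIdx (u : Fin d) (w : SignedPerm d) :
    placeAct u (toIdx (n := n) hd w) = toIdx hd (w * simpleRefl u) := by
  funext i
  refine Subtype.ext ?_
  change _ = ((w * simpleRefl u) • Letter.pos i).1
  rw [mul_smul, simpleRefl_smul_pos_eq, placeAct]
  split_ifs with hu hi
  · subst hi
    rw [Function.update_self, SignedPerm.smul_neg]
    rfl
  · rw [Function.update_of_ne hi]
    rfl
  · rfl

theorem placeAct_mem_range_iff (u : Fin d) (μ : Fin d → Idx n) :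
    placeAct u μ ∈ Set.range (toIdx hd) ↔ μ ∈ Set.range (toIdx hd) := by
  have h : ∀ μ : Fin d → Idx n, μ ∈ Set.range (toIdx hd) → placeAct u μ ∈ Set.range (toIdx hd) := by
    rintro _ ⟨w, rfl⟩
    exact ⟨_, (placeAct_toIdx hd u w).symm⟩
  exact ⟨fun hμ => placeAct_involutive u μ ▸ h _ hμ, h μ⟩

end SignedPerm

open SignedPerm

variable (K) in
/-- The basis vectors of the tensor space in the orbit of `v_1 ⊗ ⋯ ⊗ v_d`. -/
noncomputable def orbitVec (w : SignedPerm d) : TensorSpace K n d :=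
  tensorBasis K n d (toIdx hd w)

open scoped Classical in
theorem genAct_orbitVec (u : Fin d) (w : SignedPerm d) :
    genAct Q q n u (orbitVec K hd w) = orbitVec K hd (w * simpleRefl u) +
      (if Desc u w then quadCoeff Q q u else 0) • orbitVec K hd w := by
  have hswap : swapCoeff (K := K) Q q u (toIdx (n := n) hd w) = 1 := by
    unfold swapCoeff
    split_ifs with h0 h h
    · exact absurd h.symm (w • Letter.pos u).bounds.1
    · rfl
    · have hpred := smul_pred_ne_smul_pos w u
      rw [Letter.pred, if_neg h0] at hpred
      exact absurd (Subtype.ext (congrArg (fun i : Idx n => i.1) h) :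
        w • Letter.pos (prevPos u) = w • Letter.pos u) hpred
    · rfl
  have hdiag : diagCoeff (K := K) Q q u (toIdx (n := n) hd w) =
      if Desc u w then quadCoeff Q q u else 0 := by
    by_cases h0 : u.val = 0
    · have h : Desc u w ↔ (toIdx (n := n) hd w u).1 < 0 := by
        have hval : (w • Letter.pos u).1 < -(w • Letter.pos u).1 ↔ (w • Letter.pos u).1 < 0 := by
          omega
        rw [Desc, Letter.pred, if_pos h0, SignedPerm.smul_neg, ← Subtype.coe_lt_coe, Letter.neg_val,
          hval]
        rfl
      simp only [diagCoeff, quadCoeff, if_pos h0, h]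
    · have h : Desc u w ↔ toIdx (n := n) hd w u < toIdx hd w (prevPos u) := by
        rw [Desc, Letter.pred, if_neg h0]
        rfl
      simp only [diagCoeff, quadCoeff, if_neg h0, h]
  rw [orbitVec, genAct_basis, hswap, hdiag, one_smul, placeAct_toIdx]
  rfl

variable (K n) in
/-- The inversion `v_w ↦ v_{w⁻¹}` of the orbit of `v_1 ⊗ ⋯ ⊗ v_d`, extended by zero. It
interchanges the right action of the Hecke algebra on the span of the orbit with the left
multiplication under the identification of this span with the regular module. -/
noncomputable def orbitInv : Module.End K (TensorSpace K n d) :=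
  (tensorBasis K n d).constr K (Function.extend (toIdx hd) (fun w => orbitVec K hd w⁻¹) 0)

theorem orbitInv_orbitVec (w : SignedPerm d) :
    orbitInv K n hd (orbitVec K hd w) = orbitVec K hd w⁻¹ := by
  rw [orbitInv, orbitVec, Module.Basis.constr_basis, (toIdx_injective hd).extend_apply]

theorem orbitInv_of_notMem {μ : Fin d → Idx n} (hμ : μ ∉ Set.range (toIdx hd)) :
    orbitInv K n hd (tensorBasis K n d μ) = 0 := by
  rw [orbitInv, Module.Basis.constr_basis, Function.extend_apply' _ _ _ hμ, Pi.zero_apply]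

theorem orbitInv_mul_orbitInv_mul_orbitInv :
    orbitInv K n hd * (orbitInv K n hd * orbitInv K n hd) = orbitInv K n hd := by
  refine (tensorBasis K n d).ext fun μ => ?_
  simp only [Module.End.mul_apply]
  by_cases hμ : μ ∈ Set.range (toIdx hd)
  · obtain ⟨w, rfl⟩ := hμ
    rw [← orbitVec, orbitInv_orbitVec, orbitInv_orbitVec, orbitInv_orbitVec, inv_inv]
  · rw [orbitInv_of_notMem hd hμ, map_zero, map_zero]

theorem transposeEnd_orbitInv :
    transposeEnd (tensorBasis K n d) (orbitInv K n hd) = op (orbitInv K n hd) := by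
  have hrange : ∀ (w : SignedPerm d) (ν : Fin d → Idx n), ν ∉ Set.range (toIdx hd) →
      (tensorBasis K n d).repr (orbitVec K hd w) ν = 0 := fun w ν hν => by
    rw [orbitVec, Module.Basis.repr_self, Finsupp.single_eq_of_ne]
    rintro rfl
    exact hν ⟨w, rfl⟩
  refine (transposeEnd_eq_op_iff _).2 fun μ ν => ?_
  by_cases hμ : μ ∈ Set.range (toIdx hd) <;> by_cases hν : ν ∈ Set.range (toIdx hd)
  · obtain ⟨v, rfl⟩ := hμ
    obtain ⟨w, rfl⟩ := hν
    rw [← orbitVec, ← orbitVec, orbitInv_orbitVec, orbitInv_orbitVec, orbitVec, orbitVec]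
    simp only [Module.Basis.repr_self, Finsupp.single_apply, (toIdx_injective hd).eq_iff,
      inv_eq_iff_eq_inv (a := v), eq_comm (a := v)]
  · obtain ⟨v, rfl⟩ := hμ
    rw [← orbitVec, orbitInv_orbitVec, hrange _ _ hν, orbitInv_of_notMem hd hν, map_zero,
      Finsupp.zero_apply]
  · obtain ⟨w, rfl⟩ := hν
    rw [← orbitVec, orbitInv_orbitVec, hrange _ _ hμ, orbitInv_of_notMem hd hμ, map_zero,
      Finsupp.zero_apply]
  · rw [orbitInv_of_notMem hd hμ, orbitInv_of_notMem hd hν, map_zero, Finsupp.zero_apply,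
      Finsupp.zero_apply]

theorem commute_mul_orbitInv {f : Module.End K (TensorSpace K n d)} {u : Fin d}
    (h : ∀ w, f (orbitInv K n hd (genAct Q q n u (orbitVec K hd w))) =
      genAct Q q n u (f (orbitVec K hd w⁻¹))) :
    Commute (f * orbitInv K n hd) (genAct Q q n u) := by
  refine (tensorBasis K n d).ext fun μ => ?_
  simp only [Module.End.mul_apply]
  by_cases hμ : μ ∈ Set.range (toIdx hd)
  · obtain ⟨w, rfl⟩ := hμ
    rw [← orbitVec, h, orbitInv_orbitVec]
  · have hμ' : placeAct u μ ∉ Set.range (toIdx hd) := (placeAct_mem_range_iff hd u μ).not.2 hμ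
    rw [genAct_basis, map_add, map_smul, map_smul, orbitInv_of_notMem hd hμ,
      orbitInv_of_notMem hd hμ', smul_zero, smul_zero, add_zero, map_zero, map_zero]

theorem commute_orbitInv_mul_orbitInv (u : Fin d) :
    Commute (orbitInv K n hd * orbitInv K n hd) (genAct Q q n u) :=
  commute_mul_orbitInv Q q hd fun w => by
    simp only [genAct_orbitVec, map_add, map_smul, orbitInv_orbitVec, inv_inv]

open scoped Classical in
theorem orbitInv_genAct_orbitVec_inv (t : Fin d) (w : SignedPerm d) :
    orbitInv K n hd (genAct Q q n t (orbitVec K hd w⁻¹)) = orbitVec K hd (simpleRefl t * w) +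
      (if Desc t w⁻¹ then quadCoeff Q q t else 0) • orbitVec K hd w := by
  rw [genAct_orbitVec, map_add, map_smul, orbitInv_orbitVec, orbitInv_orbitVec, mul_inv_rev,
    inv_inv, simpleRefl_inv]

theorem commute_orbitInv_mul_genAct_mul_orbitInv (t u : Fin d) :
    Commute (orbitInv K n hd * genAct Q q n t * orbitInv K n hd) (genAct Q q n u) := by
  classical
  refine commute_mul_orbitInv Q q hd fun w => ?_
  rw [Module.End.mul_apply, Module.End.mul_apply, genAct_orbitVec Q q hd u w]
  simp only [map_add, map_smul, orbitInv_orbitVec, orbitInv_genAct_orbitVec_inv]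
  simp only [genAct_orbitVec, mul_assoc]
  -- If `s_t w = w s_u`, then `T_t` on the left and `T_u` on the right act on `v_w` by the same
  -- formula. Otherwise multiplication by `s_t` on the left does not affect whether `u` is a right
  -- descent of `w`, and vice versa.
  by_cases h : simpleRefl t * w = w * simpleRefl u
  · have h1 : Desc t (w * simpleRefl u)⁻¹ ↔ ¬ Desc t w⁻¹ := by
      rw [← h, mul_inv_rev, simpleRefl_inv, desc_mul_simpleRefl]
    simp only [h1, h, desc_mul_simpleRefl, desc_inv_iff_desc h,
      quadCoeff_congr Q q (eq_zero_iff_of_comm h)]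
  · simp only [desc_simpleRefl_mul h, desc_inv_mul_simpleRefl h]
    module

/-- The idempotent of the Schur algebra that projects to the span of the orbit. -/
noncomputable def orbitProj : SchurB Q q n d :=
  SchurB.ofCommute (orbitInv K n hd * orbitInv K n hd) (commute_orbitInv_mul_orbitInv Q q hd)

/-- The element of the Schur algebra that acts on the span of the orbit, identified with the
regular module, as the left multiplication by `T_t`. -/
noncomputable def orbitLeftMul (t : Fin d) : SchurB Q q n d :=
  SchurB.ofCommute (orbitInv K n hd * genAct Q q n t * orbitInv K n hd)
    (commute_orbitInv_mul_genAct_mul_orbitInv Q q hd t)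

theorem transposeEquiv_orbitProj :
    SchurB.transposeEquiv Q q n d (orbitProj Q q hd) = op (orbitProj Q q hd) :=
  SchurB.transposeEquiv_ofCommute _ <| by rw [map_mul, transposeEnd_orbitInv, op_mul]

theorem transposeEquiv_orbitLeftMul (t : Fin d) :
    SchurB.transposeEquiv Q q n d (orbitLeftMul Q q hd t) = op (orbitLeftMul Q q hd t) :=
  SchurB.transposeEquiv_ofCommute _ <| by
    rw [map_mul, map_mul, transposeEnd_orbitInv, transposeEnd_genAct, op_mul, op_mul, mul_assoc]

theorem orbitProj_orbitVec (w : SignedPerm d) :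
    orbitProj Q q hd (orbitVec K hd w) = orbitVec K hd w := by
  rw [orbitProj, SchurB.ofCommute_apply, Module.End.mul_apply, orbitInv_orbitVec,
    orbitInv_orbitVec, inv_inv]

variable (n) in
/-- The map `h ↦ v_1 ⊗ ⋯ ⊗ v_d · h`. -/
noncomputable def orbitMap : HeckeB Q q d →ₗ[(HeckeB Q q d)ᵐᵒᵖ] TensorSpace K n d where
  toFun h := op h • orbitVec K hd 1
  map_add' x y := by rw [op_add, add_smul]
  map_smul' h x := by rw [RingHom.id_apply, ← mul_smul]; rfl

theorem orbitMap_apply (h : HeckeB Q q d) : orbitMap Q q n hd h = op h • orbitVec K hd 1 := rfl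

theorem orbitVec_mem_range (w : SignedPerm d) :
    orbitVec K hd w ∈ LinearMap.range (orbitMap Q q n hd) := by
  induction w using SignedPerm.induction with
  | one => exact ⟨1, by rw [orbitMap_apply, op_one, one_smul]⟩
  | mul_simpleRefl w u hu ih =>
    obtain ⟨h, hh⟩ := ih
    refine ⟨h * HeckeB.T Q q u, ?_⟩
    rw [orbitMap_apply, op_mul, mul_smul, ← orbitMap_apply, hh, op_T_smul_eq, genAct_orbitVec,
      if_neg hu, zero_smul, add_zero]

theorem orbitProj_mem_range (v : TensorSpace K n d) :
    orbitProj Q q hd v ∈ LinearMap.range (orbitMap Q q n hd) := by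
  have h : LinearMap.range (orbitInv K n hd) ≤
      (LinearMap.range (orbitMap Q q n hd)).restrictScalars K := by
    rw [orbitInv, Module.Basis.constr_range, Submodule.span_le]
    rintro _ ⟨μ, rfl⟩
    by_cases hμ : μ ∈ Set.range (toIdx hd)
    · obtain ⟨w, rfl⟩ := hμ
      rw [(toIdx_injective hd).extend_apply]
      exact orbitVec_mem_range Q q hd w⁻¹
    · rw [Function.extend_apply' _ _ _ hμ]
      exact zero_mem _
  exact h ⟨_, rfl⟩

theorem orbitMap_injective : Function.Injective (orbitMap Q q n hd) := by
  have := Fintype.ofFinite (SignedPerm d)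
  let f : HeckeB Q q d →ₗ[K] TensorSpace K n d := (orbitMap Q q n hd).restrictScalars K
  have hspan : Submodule.span K (Set.range (orbitVec K hd)) ≤ LinearMap.range f :=
    Submodule.span_le.2 (Set.range_subset_iff.2 (orbitVec_mem_range Q q hd))
  have hcard : Module.finrank K (Submodule.span K (Set.range (orbitVec (n := n) K hd))) =
      2 ^ d * d.factorial := by
    rw [← SignedPerm.card, Nat.card_eq_fintype_card]
    exact finrank_span_eq_card ((tensorBasis K n d).linearIndependent.comp _ (toIdx_injective hd))
  have hker : LinearMap.ker f = ⊥ := by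
    have h := f.finrank_range_add_finrank_ker
    have h1 := Submodule.finrank_mono hspan
    have h2 := HeckeB.finrank_le Q q (d := d)
    exact Submodule.finrank_eq_zero.1 (by omega)
  have hf : Function.Injective f := LinearMap.ker_eq_bot.1 hker
  exact hf

/-- The coordinate of a tensor in the regular module spanned by the orbit of
`v_1 ⊗ ⋯ ⊗ v_d`. -/
noncomputable def orbitCoord : TensorSpace K n d →ₗ[(HeckeB Q q d)ᵐᵒᵖ] HeckeB Q q d :=
  (LinearEquiv.ofInjective (orbitMap Q q n hd) (orbitMap_injective Q q hd)).symm.toLinearMap ∘ₗ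
    LinearMap.codRestrict _ (orbitProj Q q hd) (orbitProj_mem_range Q q hd)

theorem orbitMap_orbitCoord (v : TensorSpace K n d) :
    orbitMap Q q n hd (orbitCoord Q q hd v) = orbitProj Q q hd v :=
  congrArg Subtype.val ((LinearEquiv.ofInjective (orbitMap Q q n hd)
    (orbitMap_injective Q q hd)).apply_symm_apply ⟨_, orbitProj_mem_range Q q hd v⟩)

theorem orbitCoord_orbitVec_one : orbitCoord Q q hd (orbitVec (n := n) K hd 1) = 1 := by
  apply orbitMap_injective (n := n) Q q hd
  rw [orbitMap_orbitCoord, orbitMap_apply, op_one, one_smul, orbitProj_orbitVec]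

theorem rankOne_orbitCoord_one :
    rankOne (orbitCoord Q q hd) (orbitVec (n := n) K hd 1) = orbitProj Q q hd :=
  LinearMap.ext (orbitMap_orbitCoord Q q hd)

theorem orbitLeftMul_mul_orbitProj (t : Fin d) :
    orbitLeftMul Q q hd t * orbitProj Q q hd = orbitLeftMul Q q hd t :=
  LinearMap.ext fun v => by
    have h := LinearMap.congr_fun (orbitInv_mul_orbitInv_mul_orbitInv (K := K) (n := n) hd) v
    rw [Module.End.mul_apply, Module.End.mul_apply] at h
    simp only [Module.End.mul_apply, orbitLeftMul, orbitProj, SchurB.ofCommute_apply, h]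

theorem orbitLeftMul_orbitVec_one (t : Fin d) :
    orbitLeftMul Q q hd t (orbitVec (n := n) K hd 1) =
      op (HeckeB.T Q q t) • orbitVec K hd 1 := by
  classical
  have hT : op (HeckeB.T Q q t) • orbitVec (n := n) K hd 1 = orbitVec K hd (simpleRefl t) := by
    rw [op_T_smul_eq, genAct_orbitVec, if_neg (not_desc_one t), zero_smul, add_zero, one_mul]
  rw [orbitLeftMul, SchurB.ofCommute_apply, Module.End.mul_apply, Module.End.mul_apply,
    orbitInv_orbitVec, inv_one, ← op_T_smul_eq, hT, orbitInv_orbitVec, simpleRefl_inv]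

theorem rankOne_orbitCoord_T (t : Fin d) :
    rankOne (orbitCoord Q q hd) (op (HeckeB.T Q q t) • orbitVec (n := n) K hd 1) =
      orbitLeftMul Q q hd t := by
  rw [← orbitLeftMul_orbitVec_one]
  refine rankOne_apply_base_of_mul_eq ?_
  rw [rankOne_orbitCoord_one, orbitLeftMul_mul_orbitProj]

theorem transposeEquiv_rankOne_one :
    SchurB.transposeEquiv Q q n d (rankOne (orbitCoord Q q hd) (orbitVec K hd 1)) =
      op (rankOne (orbitCoord Q q hd) (orbitVec K hd 1)) := by
  rw [rankOne_orbitCoord_one, transposeEquiv_orbitProj]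

theorem transposeEquiv_cornerEquiv_symm (h : HeckeB Q q d) :
    SchurB.transposeEquiv Q q n d
        ((cornerEquiv (K := K) (orbitCoord_orbitVec_one (n := n) Q q hd)).symm h).1 =
      op ((cornerEquiv (K := K) (orbitCoord_orbitVec_one (n := n) Q q hd)).symm
        (HeckeB.anti Q q d h).unop).1 := by
  refine map_cornerEquiv_symm _ (transposeEquiv_rankOne_one Q q hd) (HeckeB.adjoin_T Q q) ?_ h
  rintro _ ⟨t, rfl⟩
  rw [HeckeB.anti_T, unop_op, cornerEquiv_symm_apply, rankOne_orbitCoord_T,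
    transposeEquiv_orbitLeftMul]

end Orbit

end TypeB

theorem proposition4p1 {K : Type u} [Field K] (Q q : Kˣ) (n d : ℕ) (hd : d ≤ n / 2) :
    ∃ (e : TypeB.SchurB Q q n d) (he : IsIdempotentElem e)
      (ψ : he.Corner ≃ₐ[K] TypeB.HeckeB Q q d),
      -- `S e ≅ V^{⊗d}` as `(S, H)`-bimodules, where `H` acts on `S e` on the right through `ψ`
      (∃ Φ : TypeB.TensorSpace K n d ≃ₗ[TypeB.SchurB Q q n d]
            Submodule.span (TypeB.SchurB Q q n d) {e},
          ∀ (v : TypeB.TensorSpace K n d) (h : TypeB.HeckeB Q q d),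
            (Φ (op h • v)).1 = (Φ v).1 * (ψ.symm h).1) ∧
      -- `e S ≅ V^{⊗d}` as `(S, H)`-bimodules, where `S` and `H` act on `e S` through right and
      -- left multiplication and the standard anti-automorphisms: transposition `τ` on `S`, and
      -- the anti-automorphism `σ` of `H` that fixes all `T_t`
      (∃ (τ : TypeB.SchurB Q q n d ≃ₐ[K] (TypeB.SchurB Q q n d)ᵐᵒᵖ)
          (σ : TypeB.HeckeB Q q d ≃ₐ[K] (TypeB.HeckeB Q q d)ᵐᵒᵖ),
          (∀ (s : TypeB.SchurB Q q n d) (μ ν : Fin d → TypeB.Idx n),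
            (TypeB.tensorBasis K n d).repr ((τ s).unop (TypeB.tensorBasis K n d μ)) ν =
              (TypeB.tensorBasis K n d).repr (s (TypeB.tensorBasis K n d ν)) μ) ∧
          (∀ t : Fin d, σ (TypeB.HeckeB.T Q q t) = op (TypeB.HeckeB.T Q q t)) ∧
          ∃ Θ : TypeB.TensorSpace K n d ≃+ Submodule.span (TypeB.SchurB Q q n d)ᵐᵒᵖ {e},
            (∀ (s : TypeB.SchurB Q q n d) (v : TypeB.TensorSpace K n d),
              (Θ (s • v)).1 = (Θ v).1 * (τ s).unop) ∧
            (∀ (v : TypeB.TensorSpace K n d) (h : TypeB.HeckeB Q q d),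
              (Θ (op h • v)).1 = (ψ.symm (σ h).unop).1 * (Θ v).1)) ∧
      -- the Schur functor `M ↦ e M` from `S`-modules to `H`-modules
      (∃ (F : CategoryTheory.Functor (ModuleCat.{w} (TypeB.SchurB Q q n d))
            (ModuleCat.{w} (TypeB.HeckeB Q q d)))
          (η : ∀ M : ModuleCat.{w} (TypeB.SchurB Q q n d), F.obj M ≃+ TypeB.idemPart e M),
          (∀ (M : ModuleCat.{w} (TypeB.SchurB Q q n d)) (h : TypeB.HeckeB Q q d) (x : F.obj M),
            (η M (h • x)).1 = (ψ.symm h).1 • (η M x).1) ∧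
          (∀ (M N : ModuleCat.{w} (TypeB.SchurB Q q n d)) (f : M ⟶ N) (x : F.obj M),
            (η N ((F.map f).hom x)).1 = f.hom (η M x).1)) := by
  have hβ := TypeB.orbitCoord_orbitVec_one (n := n) Q q hd
  have hτ := TypeB.transposeEquiv_rankOne_one (n := n) Q q hd
  refine ⟨_, TypeB.isIdempotentElem_rankOne hβ, TypeB.cornerEquiv hβ,
    ⟨TypeB.leftIdealEquiv hβ, TypeB.leftIdealEquiv_smul hβ⟩,
    ⟨TypeB.SchurB.transposeEquiv Q q n d, TypeB.HeckeB.anti Q q d,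
      TypeB.SchurB.repr_transposeEquiv, TypeB.HeckeB.anti_T Q q, TypeB.rightIdealEquiv hβ hτ,
      TypeB.rightIdealEquiv_smul hβ hτ, fun v h => ?_⟩,
    TypeB.exists_idemFunctor _ (TypeB.cornerEquiv (K := K) hβ).symm.toAlgHom.toRingHom⟩
  rw [TypeB.rightIdealEquiv_op_smul, TypeB.transposeEquiv_cornerEquiv_symm, unop_op]
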